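/- \textbf{Lemma (Reduction).} Let $k\ge 1$ be odd and $\gamma\in\mathbb{R}$. There exist constants $0<\rho_2<1$, namely $\rho_2=(1+\sqrt2)/\sqrt8$, and $\Lambda_2>0$ depending only on $k$ and $\gamma$, such that the following holds. Let $\Omega\subset\mathbb{R}^2$ be a bounded polygonal Lipschitz domain, $f\in L^2(\Omega)$, and let $\mathcal{T}_0$ be a conforming triangulation of $\Omega$ into closed triangles, with an arbitrary choice of a refinement edge for each triangle, whose shape-regularity constant $\gamma_{\mathcal{T}_0}=\max_{K\in\mathcal{T}_0}h_K/\rho_K$ ($h_K$ the diameter of $K$, $\rho_K$ the diameter of the largest inscribed disc) satisfies $\gamma_{\mathcal{T}_0}\le\gamma$. Call a conforming triangulation of $\Omega$ an admissible refinement of $\mathcal{T}$ if it is generated from $\mathcal{T}$ by finitely many newest vertex bisections (each replaces one triangle by the two halves obtained by joining the midpoint of its refinement edge to the opposite vertex; the refinement edge of each half is its edge opposite to that midpoint). Let $\mathcal{T}$ be an admissible refinement of $\mathcal{T}_0$ and $\widehat{\mathcal{T}}$ an admissible refinement of $\mathcal{T}$. Then for all $v\in \mathrm{CR}_{k,0}(\mathcal{T})$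 and $\widehat v\in \mathrm{CR}_{k,0}(\widehat{\mathcal{T}})$ \[ \eta(\widehat v;\widehat{\mathcal{T}}\setminus\mathcal{T},f)^2\le \rho_2\,\eta(v;\mathcal{T}\setminus\widehat{\mathcal{T}},f)^2+\Lambda_2\,\|\nabla_{\mathcal{T}}v-\nabla_{\widehat{\mathcal{T}}}\widehat v\|_{\mathbf{L}^2(\Omega)}^2 . \] Here $\nabla_{\mathcal{T}}$ is the piecewise gradient. For each edge $E$ fix a numbering $z_0,z_1$ of its endpoints, with unit tangent $\mathbf{t}_E=(z_1-z_0)/|E|$ and unit normal $\mathbf{n}_E=(-t_{E,2},t_{E,1})$, numbered so that $\mathbf{n}_E$ points out of $\Omega$ on boundary edges. For an interior edge $E$ (one not contained in $\partial\Omega$), $[\![u]\!]_E=u|_{K_L}-u|_{K_R}$, where $K_L,K_R$ are the two triangles sharing $E$ and $\mathbf{n}_E$ points into $K_R$; for a boundary edge, $[\![u]\!]_E$ is the trace of $u$ from the only adjacent triangle. The space $\mathrm{CR}_{k,0}(\mathcal{T})$ consists of the functions $v$ that are polynomials of total degree at most $k$ on each $K\in\mathcal{T}$ and satisfy $\int_E[\![v]\!]_E\,q\,ds=0$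 for every edge $E$ of $\mathcal{T}$, interior or boundary, and every polynomial $q$ of degree at most $k-1$. For $\mathcal{S}\subseteq\mathcal{T}$ the estimator is \[ \eta(v;\mathcal{S},f)^2=\sum_{K\in\mathcal{S}}\Big(|K|\,\|f+\Delta v\|_{L^2(K)}^2+|K|^{1/2}\sum_{E\in\mathcal{E}_\Omega(K)}\|\langle[\![\nabla_{\mathcal{T}}v]\!]_E,\mathbf{n}_E\rangle\|_{L^2(E)}^2+|K|^{1/2}\sum_{E\in\mathcal{E}(K)}\|\langle[\![\nabla_{\mathcal{T}}v]\!]_E,\mathbf{t}_E\rangle\|_{L^2(E)}^2\Big), \] where $\mathcal{E}(K)$ is the set of edges of $K$, $\mathcal{E}_\Omega(K)$ that of its interior edges, and $|K|$ the area of $K$; $\eta(\widehat v;\cdot,f)$ is defined in the same way with $\widehat{\mathcal{T}}$ in place of $\mathcal{T}$. -/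

import Mathlib

open MeasureTheory Set
open scoped RealInnerProductSpace Classical

noncomputable section

namespace CRMesh

/-- The Euclidean plane. -/
abbrev Pt : Type := EuclideanSpace ℝ (Fin 2)

/-! ### Domains, triangles and triangulations -/

/-- A bounded polygonal Lipschitz domain: a bounded, open, connected, nonempty set whose boundary is
a finite union of line segments and which, near each boundary point, is the strict epigraph of a
Lipschitz function in suitable Cartesian coordinates. -/
structure IsPolygonalLipschitzDomain (Ω : Set Pt) : Prop where
  isOpen : IsOpen Ω
  isBounded : Bornology.IsBounded Ω
  isConnected : IsConnected Ω
  polygonal : ∃ S : Finset (Pt × Pt), frontier Ω = ⋃ s ∈ S, segment ℝ s.1 s.2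
  lipschitz : ∀ x ∈ frontier Ω, ∃ (e : Pt ≃ₗᵢ[ℝ] Pt) (φ : ℝ → ℝ) (L : NNReal) (δ : ℝ),
    LipschitzWith L φ ∧ 0 < δ ∧ ∀ y ∈ Metric.ball x δ, (y ∈ Ω ↔ φ (e y 0) < e y 1)

/-- Triangles and edges are given by their vertex sets; `hull s` is the closed triangle (segment)
with vertex set `s`. -/
def hull (s : Finset Pt) : Set Pt := convexHull ℝ (s : Set Pt)

/-- Three vertices that are not collinear. -/
def IsTriangle (K : Finset Pt) : Prop :=
  K.card = 3 ∧ AffineIndependent ℝ ((↑) : K → Pt)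

/-- The three edges of a triangle. -/
def edgesOf (K : Finset Pt) : Finset (Finset Pt) := K.powersetCard 2

/-- All edges of a mesh. -/
def edges (T : Finset (Finset Pt)) : Finset (Finset Pt) := T.biUnion edgesOf

/-- The edge `E` lies on the boundary of the domain. -/
def IsBoundaryEdge (Ω : Set Pt) (E : Finset Pt) : Prop := hull E ⊆ frontier Ω

/-- The edges of `K` that do not lie on the boundary of the domain. -/
def interiorEdgesOf (Ω : Set Pt) (K : Finset Pt) : Finset (Finset Pt) :=
  (edgesOf K).filter fun E => ¬ IsBoundaryEdge Ω E

/-- A conforming triangulation of `Ω`.  Two triangles meet in the hull of their common vertices: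
that is, they are equal, or meet in a common edge, in a common vertex, or not at all. -/
structure IsTriangulation (Ω : Set Pt) (T : Finset (Finset Pt)) : Prop where
  isTriangle : ∀ K ∈ T, IsTriangle K
  conforming : ∀ K ∈ T, ∀ K' ∈ T, hull K ∩ hull K' = hull (K ∩ K')
  cover : ⋃ K ∈ T, hull K = closure Ω

/-- The area of a triangle. -/
def area (K : Finset Pt) : ℝ := volume.real (hull K)

/-- The diameter of the largest disc contained in a triangle. -/
def inDiam (K : Finset Pt) : ℝ :=
  sSup {d : ℝ | 0 ≤ d ∧ ∃ c : Pt, Metric.closedBall c (d / 2) ⊆ hull K}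

/-- The shape-regularity constant: the maximum over the (finite) mesh of the ratio of the diameter
of a triangle and the diameter of its largest inscribed disc. -/
def shapeRegularity (T : Finset (Finset Pt)) : ℝ :=
  sSup ((fun K => Metric.diam (hull K) / inDiam K) '' (T : Set (Finset Pt)))

/-! ### Newest vertex bisection -/

/-- A mesh together with a refinement edge for each of its triangles, namely the edge opposite to
the newest vertex.  Only the values of `refEdge` on triangles of the mesh matter. -/
structure LabelledMesh where
  tri : Finset (Finset Pt)
  refEdge : Finset Pt → Finset Pt

/-- `M'` arises from `M` by a single newest vertex bisection: a triangle with newest vertex `z` and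
refinement edge `{a, b}` is replaced by its two halves with the midpoint `m` of `a` and `b` as
newest vertex of both halves. -/
def NVBStep (M M' : LabelledMesh) : Prop :=
  ∃ z a b m : Pt, m = midpoint ℝ a b ∧
    ({z, a, b} : Finset Pt) ∈ M.tri ∧ M.refEdge {z, a, b} = {a, b} ∧
    M'.tri = (M.tri.erase {z, a, b}) ∪ {{m, z, a}, {m, z, b}} ∧
    M'.refEdge {m, z, a} = {z, a} ∧ M'.refEdge {m, z, b} = {z, b} ∧
    ∀ L ∈ M.tri, L ≠ {z, a, b} → M'.refEdge L = M.refEdge L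

/-- An initial mesh: a conforming triangulation with an arbitrary choice of refinement edges. -/
structure IsInitialMesh (Ω : Set Pt) (M : LabelledMesh) : Prop where
  isTriangulation : IsTriangulation Ω M.tri
  refEdge_mem : ∀ K ∈ M.tri, M.refEdge K ∈ edgesOf K

/-- `M'` is an admissible refinement of `M`: a conforming triangulation generated from `M` by a
finite series of newest vertex bisections. -/
def IsAdmissibleRefinement (Ω : Set Pt) (M M' : LabelledMesh) : Prop :=
  Relation.ReflTransGen NVBStep M M' ∧ IsTriangulation Ω M'.tri

/-! ### Numbered edges, normals, tangents -/

/-- A numbering of the endpoints of each edge. -/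
structure EdgeNumbering where
  fst : Finset Pt → Pt
  snd : Finset Pt → Pt

namespace EdgeNumbering

/-- The unit tangent vector of an edge induced by the numbering of its endpoints. -/
def tangent (N : EdgeNumbering) (E : Finset Pt) : Pt :=
  (dist (N.fst E) (N.snd E))⁻¹ • (N.snd E - N.fst E)

/-- The unit normal vector of an edge induced by the numbering of its endpoints. -/
def normal (N : EdgeNumbering) (E : Finset Pt) : Pt :=
  !₂[-(N.tangent E 1), N.tangent E 0]

/-- The normal vector of the edge `E` of `K` points into the triangle `K`. -/
def PointsInto (N : EdgeNumbering) (E K : Finset Pt) : Prop :=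
  ∃ z ∈ K, 0 < ⟪N.normal E, z - N.fst E⟫

/-- The numbering enumerates the endpoints of each edge of the mesh, and the normals of
boundary edges point into the exterior of the domain. -/
structure IsFor (N : EdgeNumbering) (Ω : Set Pt) (T : Finset (Finset Pt)) : Prop where
  ends : ∀ E ∈ edges T, E = {N.fst E, N.snd E}
  outward : ∀ E ∈ edges T, IsBoundaryEdge Ω E →
    ∀ K ∈ T, E ∈ edgesOf K → ¬ N.PointsInto E K

end EdgeNumbering

/-! ### Piecewise polynomials, traces and jumps -/

/-- The value of a bivariate real polynomial at a point of the plane. -/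
def polyEval (p : MvPolynomial (Fin 2) ℝ) (x : Pt) : ℝ := MvPolynomial.eval (fun i => x i) p

/-- On the interior of each triangle, `v` is a polynomial of total degree at most `k`.  The values
of `v` outside the open triangles are irrelevant. -/
def IsPiecewisePoly (k : ℕ) (T : Finset (Finset Pt)) (v : Pt → ℝ) : Prop :=
  ∀ K ∈ T, ∃ p : MvPolynomial (Fin 2) ℝ, p.totalDegree ≤ k ∧
    ∀ x ∈ interior (hull K), v x = polyEval p x

/-- The piecewise gradient: on the interior of each triangle it is the gradient. -/
def brokenGrad (T : Finset (Finset Pt)) (v : Pt → ℝ) : Pt → Pt :=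
  (⋃ K ∈ T, interior (hull K)).indicator (gradient v)

/-- The restriction to the closed triangle `K` of a piecewise defined function: the continuous
continuation to `K` of the restriction to the interior of `K`. -/
def trace {V : Type} [NormedAddCommGroup V] (K : Finset Pt) (u : Pt → V) : Pt → V :=
  extendFrom (interior (hull K)) u

/-- The jump over the edge `E`.  For an interior edge it is the trace from the adjacent triangle
out of which the normal points minus the trace from the one into which it points; for
a boundary edge it is the trace from the only adjacent triangle. -/
def jump {V : Type} [NormedAddCommGroup V] (T : Finset (Finset Pt)) (N : EdgeNumbering)
    (E : Finset Pt) (u : Pt → V) (x : Pt) : V :=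
  ∑ K ∈ T.filter (fun K => E ∈ edgesOf K),
    if N.PointsInto E K then -(trace K u x) else trace K u x

/-- The integral over an edge with respect to arc length. -/
def edgeIntegral (E : Finset Pt) (g : Pt → ℝ) : ℝ :=
  ∫ x in hull E, g x ∂(Measure.hausdorffMeasure 1)

/-- The Crouzeix-Raviart space of degree `k` with homogeneous boundary conditions: piecewise
polynomials of degree at most `k` whose jumps over interior edges and whose
traces on boundary edges are orthogonal to the polynomials of degree at most `k - 1`. -/
structure IsCR0 (k : ℕ) (Ω : Set Pt) (T : Finset (Finset Pt)) (N : EdgeNumbering)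
    (v : Pt → ℝ) : Prop where
  piecewisePoly : IsPiecewisePoly k T v
  interior_jump : ∀ E ∈ edges T, ¬ IsBoundaryEdge Ω E →
    ∀ q : MvPolynomial (Fin 2) ℝ, q.totalDegree < k →
      edgeIntegral E (fun x => jump T N E v x * polyEval q x) = 0
  boundary_trace : ∀ E ∈ edges T, IsBoundaryEdge Ω E →
    ∀ K ∈ T, E ∈ edgesOf K → ∀ q : MvPolynomial (Fin 2) ℝ, q.totalDegree < k →
      edgeIntegral E (fun x => trace K v x * polyEval q x) = 0

/-! ### The residual error estimator -/

/-- The square of the conformity part of the local estimator: element residuals and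
normal jumps of the gradient. -/
def muSq (Ω : Set Pt) (T : Finset (Finset Pt)) (N : EdgeNumbering) (f v : Pt → ℝ)
    (K : Finset Pt) : ℝ :=
  area K * (∫ x in interior (hull K), (f x + Laplacian.laplacian v x) ^ 2) +
    √(area K) * ∑ E ∈ interiorEdgesOf Ω K,
      edgeIntegral E (fun x => ⟪jump T N E (brokenGrad T v) x, N.normal E⟫ ^ 2)

/-- The square of the nonconformity part of the local estimator: tangential jumps. -/
def nuSq (T : Finset (Finset Pt)) (N : EdgeNumbering) (v : Pt → ℝ) (K : Finset Pt) : ℝ :=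
  √(area K) * ∑ E ∈ edgesOf K,
    edgeIntegral E (fun x => ⟪jump T N E (brokenGrad T v) x, N.tangent E⟫ ^ 2)

/-- The estimator of `v` on the sub-mesh `S` of `T`. -/
def eta (Ω : Set Pt) (T : Finset (Finset Pt)) (N : EdgeNumbering) (f v : Pt → ℝ)
    (S : Finset (Finset Pt)) : ℝ :=
  √(∑ K ∈ S, (muSq Ω T N f v K + nuSq T N v K))

/-- The norm of a vector field in `L²(Ω)`. -/
def l2Norm (Ω : Set Pt) (g : Pt → Pt) : ℝ := √(∫ x in Ω, ‖g x‖ ^ 2)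

end CRMesh

end

noncomputable section

open MeasureTheory Set Filter Topology
open scoped RealInnerProductSpace Classical

namespace CRMesh

variable {Ω : Set Pt} {T T' : Finset (Finset Pt)}

/-! ### Planar geometry of triangles -/

/-- The determinant of two plane vectors. -/
def cross (p q : Pt) : ℝ := p 0 * q 1 - p 1 * q 0

lemma cross_smul_left (c : ℝ) (p q : Pt) : cross (c • p) q = c * cross p q := by
  simp [cross]; ring

lemma cross_smul_right (c : ℝ) (p q : Pt) : cross p (c • q) = c * cross p q := by
  simp [cross]; ring

lemma cross_add_right (p q r : Pt) : cross p (q + r) = cross p q + cross p r := by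
  simp [cross]; ring

lemma cross_self (p : Pt) : cross p p = 0 := by
  simp [cross]; ring

lemma pt_ext {x y : Pt} (h0 : x 0 = y 0) (h1 : x 1 = y 1) : x = y := by
  ext i; fin_cases i <;> simpa

lemma continuous_coord (i : Fin 2) : Continuous fun x : Pt => x i := by
  fun_prop

lemma norm_sq_pt (x : Pt) : ‖x‖ ^ 2 = x 0 ^ 2 + x 1 ^ 2 := by
  rw [EuclideanSpace.norm_sq_eq]; simp [Fin.sum_univ_two]

lemma inner_pt (x y : Pt) : ⟪x, y⟫ = x 0 * y 0 + x 1 * y 1 := by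
  simp [PiLp.inner_apply, Fin.sum_univ_two, mul_comm]

lemma cross_sq_add_inner_sq (p q : Pt) : cross p q ^ 2 + ⟪p, q⟫ ^ 2 = ‖p‖ ^ 2 * ‖q‖ ^ 2 := by
  rw [norm_sq_pt, norm_sq_pt, inner_pt, cross]; ring

lemma abs_cross_le (p q : Pt) : |cross p q| ≤ ‖p‖ * ‖q‖ := by
  apply abs_le_of_sq_le_sq _ (by positivity)
  rw [mul_pow, ← cross_sq_add_inner_sq]
  nlinarith [sq_nonneg ⟪p, q⟫]

lemma mem_hull_of_mem {K : Finset Pt} {x : Pt} (hx : x ∈ K) : x ∈ hull K :=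
  subset_convexHull ℝ _ (by exact_mod_cast hx)

lemma convex_hull (K : Finset Pt) : Convex ℝ (hull K) := convex_convexHull ℝ _

lemma hull_mono {A B : Finset Pt} (h : A ⊆ B) : hull A ⊆ hull B :=
  convexHull_mono (by exact_mod_cast h)

lemma hull_subset_hull {A B : Finset Pt} (h : ∀ x ∈ A, x ∈ hull B) : hull A ⊆ hull B :=
  convexHull_min (fun x hx => h x (by exact_mod_cast hx)) (convex_hull B)

lemma isCompact_hull (K : Finset Pt) : IsCompact (hull K) :=
  K.finite_toSet.isCompact_convexHull ℝ

lemma isClosed_hull (K : Finset Pt) : IsClosed (hull K) := (isCompact_hull K).isClosed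

lemma hull_pair (a b : Pt) : hull {a, b} = segment ℝ a b := by
  simp [hull, convexHull_pair]

lemma hull_triple (z a b : Pt) : hull {z, a, b} =
    {x | ∃ s t : ℝ, 0 ≤ s ∧ 0 ≤ t ∧ s + t ≤ 1 ∧ x = z + s • (a - z) + t • (b - z)} := by
  have h : hull {z, a, b} = convexJoin ℝ {z} (segment ℝ a b) := by
    have : ((({z, a, b} : Finset Pt)) : Set Pt) = insert z {a, b} := by simp
    rw [hull, this, convexHull_insert (by simp), convexHull_pair]
  rw [h]
  ext x
  simp only [convexJoin_singleton_left, mem_iUnion, exists_prop, mem_ofPred_eq]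
  constructor
  · rintro ⟨y, ⟨c, d, hc, hd, hcd, rfl⟩, e, f, he, hf, hef, rfl⟩
    refine ⟨f * c, f * d, by positivity, by positivity, ?_, ?_⟩
    · rw [← mul_add, hcd]; linarith
    · have : e = 1 - f := by linarith
      have : c = 1 - d := by linarith
      subst e; subst c
      module
  · rintro ⟨s, t, hs, ht, hst, rfl⟩
    by_cases h0 : s + t = 0
    · have : s = 0 := by linarith
      have : t = 0 := by linarith
      subst s; subst t
      exact ⟨a, left_mem_segment _ _ _, by simp [left_mem_segment]⟩
    · refine ⟨(s / (s + t)) • a + (t / (s + t)) • b,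
        ⟨s / (s + t), t / (s + t), by positivity, by positivity, by field_simp, rfl⟩,
        1 - (s + t), s + t, by linarith, by positivity, by ring, ?_⟩
      rw [smul_add, smul_smul, smul_smul, mul_div_cancel₀ _ h0, mul_div_cancel₀ _ h0]
      module

/-- Cramer's rule in the plane. -/
lemma cramer {p q : Pt} (h : cross p q ≠ 0) (x : Pt) :
    x = (cross x q / cross p q) • p + (cross p x / cross p q) • q := by
  rw [div_eq_inv_mul, div_eq_inv_mul, mul_smul, mul_smul, ← smul_add, eq_inv_smul_iff₀ h]
  apply pt_ext <;> simp only [PiLp.add_apply, PiLp.smul_apply, smul_eq_mul, cross] <;> ring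

lemma mem_hull_triple {z a b : Pt} (h : cross (a - z) (b - z) ≠ 0) (x : Pt) :
    x ∈ hull {z, a, b} ↔ 0 ≤ cross (x - z) (b - z) / cross (a - z) (b - z) ∧
      0 ≤ cross (a - z) (x - z) / cross (a - z) (b - z) ∧
      0 ≤ cross (b - a) (x - a) / cross (a - z) (b - z) := by
  have h3 : cross (b - a) (x - a) / cross (a - z) (b - z) =
      1 - cross (x - z) (b - z) / cross (a - z) (b - z)
        - cross (a - z) (x - z) / cross (a - z) (b - z) := by
    rw [eq_sub_iff_add_eq, eq_sub_iff_add_eq, ← add_div, ← add_div, div_eq_one_iff_eq h]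
    simp [cross]; ring
  rw [h3, hull_triple]
  constructor
  · rintro ⟨s, t, hs, ht, hst, rfl⟩
    have e1 : cross (z + s • (a - z) + t • (b - z) - z) (b - z) / cross (a - z) (b - z) = s := by
      rw [div_eq_iff h]; simp [cross]; ring
    have e2 : cross (a - z) (z + s • (a - z) + t • (b - z) - z) / cross (a - z) (b - z) = t := by
      rw [div_eq_iff h]; simp [cross]; ring
    rw [e1, e2]
    exact ⟨hs, ht, by linarith⟩
  · rintro ⟨h1, h2, h4⟩
    refine ⟨_, _, h1, h2, by linarith, ?_⟩
    rw [add_assoc, ← cramer h (x - z)]; simp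

lemma continuous_cross {f g : Pt → Pt} (hf : Continuous f) (hg : Continuous g) :
    Continuous fun x => cross (f x) (g x) := by
  unfold cross; fun_prop

lemma mem_interior_hull_triple {z a b : Pt} (h : cross (a - z) (b - z) ≠ 0) {x : Pt}
    (h1 : 0 < cross (x - z) (b - z) / cross (a - z) (b - z))
    (h2 : 0 < cross (a - z) (x - z) / cross (a - z) (b - z))
    (h3 : 0 < cross (b - a) (x - a) / cross (a - z) (b - z)) :
    x ∈ interior (hull {z, a, b}) := by
  rw [mem_interior_iff_mem_nhds]
  have c1 : Continuous fun x : Pt => cross (x - z) (b - z) / cross (a - z) (b - z) :=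
    (continuous_cross (by fun_prop) (by fun_prop)).div_const _
  have c2 : Continuous fun x : Pt => cross (a - z) (x - z) / cross (a - z) (b - z) :=
    (continuous_cross (by fun_prop) (by fun_prop)).div_const _
  have c3 : Continuous fun x : Pt => cross (b - a) (x - a) / cross (a - z) (b - z) :=
    (continuous_cross (by fun_prop) (by fun_prop)).div_const _
  filter_upwards [c1.continuousAt.eventually (lt_mem_nhds h1),
    c2.continuousAt.eventually (lt_mem_nhds h2), c3.continuousAt.eventually (lt_mem_nhds h3)]
    with y y1 y2 y3
  exact (mem_hull_triple h y).2 ⟨y1.le, y2.le, y3.le⟩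

lemma collinear_of_cross_eq_zero {z a b : Pt} (h : cross (a - z) (b - z) = 0) :
    Collinear ℝ ({z, a, b} : Set Pt) := by
  by_cases haz : a = z
  · subst haz
    simpa using collinear_pair ℝ a b
  · rw [collinear_iff_of_mem (p₀ := z) (by simp)]
    have hp : ‖a - z‖ ^ 2 ≠ 0 := by
      have := norm_pos_iff.2 (sub_ne_zero.2 haz)
      positivity
    refine ⟨a - z, ?_⟩
    simp only [mem_insert_iff, mem_singleton_iff, forall_eq_or_imp, forall_eq, vadd_eq_add]
    refine ⟨⟨0, by simp⟩, ⟨1, by simp⟩, ⟪a - z, b - z⟫ / ‖a - z‖ ^ 2, ?_⟩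
    rw [← sub_eq_iff_eq_add]
    rw [norm_sq_pt] at hp ⊢
    rw [inner_pt]
    set p := a - z
    set q := b - z
    rw [cross] at h
    apply pt_ext <;> simp only [PiLp.smul_apply, smul_eq_mul] <;> field_simp
    · linear_combination (-p 1) * h
    · linear_combination (p 0) * h

lemma IsTriangle.cross_ne_zero {z a b : Pt} (h : IsTriangle {z, a, b}) :
    cross (a - z) (b - z) ≠ 0 := by
  intro h0
  have hc := collinear_of_cross_eq_zero h0
  have h1 := h.2
  rw [affineIndependent_iff_finrank_vectorSpan_eq ℝ (n := 2) _ (by simpa using h.1)] at h1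
  rw [collinear_iff_finrank_le_one] at hc
  have e : range (Subtype.val : ({z, a, b} : Finset Pt) → Pt) = {z, a, b} := by
    ext x; simp
  have h2 : Module.finrank ℝ (vectorSpan ℝ (range (Subtype.val : ({z, a, b} : Finset Pt) → Pt))) =
      Module.finrank ℝ (vectorSpan ℝ ({z, a, b} : Set Pt)) := by rw [e]
  omega

lemma IsTriangle.exists_apex {K E : Finset Pt} (hK : IsTriangle K) (hE : E ∈ edgesOf K) {a b : Pt}
    (hab : E = {a, b}) : ∃ z, K = {z, a, b} ∧ z ∉ E ∧ cross (a - z) (b - z) ≠ 0 := by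
  rw [edgesOf, Finset.mem_powersetCard] at hE
  have h1 : (K \ E).card = 1 := by
    rw [Finset.card_sdiff_of_subset hE.1, hK.1, hE.2]
  obtain ⟨z, hz⟩ := Finset.card_eq_one.1 h1
  have hKz : K = {z, a, b} := by
    rw [← Finset.sdiff_union_of_subset hE.1, hz, hab]; rfl
  refine ⟨z, hKz, ?_, ?_⟩
  · have : z ∈ K \ E := by rw [hz]; simp
    exact (Finset.mem_sdiff.1 this).2
  · rw [hKz] at hK; exact hK.cross_ne_zero

lemma exists_pair_of_mem_edgesOf {K E : Finset Pt} (hE : E ∈ edgesOf K) :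
    ∃ a b, a ≠ b ∧ E = {a, b} := by
  rw [edgesOf, Finset.mem_powersetCard] at hE
  exact Finset.card_eq_two.1 hE.2

lemma IsTriangle.exists_rep {K : Finset Pt} (hK : IsTriangle K) :
    ∃ z a b, K = {z, a, b} ∧ cross (a - z) (b - z) ≠ 0 := by
  obtain ⟨z, a, b, _, _, _, rfl⟩ := Finset.card_eq_three.1 hK.1
  exact ⟨z, a, b, rfl, hK.cross_ne_zero⟩

lemma cross_apex (z a b : Pt) : cross (b - a) (z - a) = cross (a - z) (b - z) := by
  simp [cross]; ring

lemma cross_swap_apex (z a b : Pt) : cross (b - z) (a - z) = -cross (a - z) (b - z) := by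
  simp [cross]; ring

lemma cross_rot (z a b : Pt) : cross (z - a) (b - a) = -cross (a - z) (b - z) := by
  simp [cross]; ring

lemma edgesOf_triple {z a b : Pt} (h : cross (a - z) (b - z) ≠ 0) {E : Finset Pt} :
    E ∈ edgesOf {z, a, b} ↔ E = {a, b} ∨ E = {z, a} ∨ E = {z, b} := by
  have hab : a ≠ b := by rintro rfl; exact h (cross_self _)
  have hza : z ≠ a := by rintro rfl; exact h (by simp [cross])
  have hzb : z ≠ b := by rintro rfl; exact h (by simp [cross])
  rw [edgesOf, Finset.mem_powersetCard]
  constructor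
  · rintro ⟨hs, hc⟩
    obtain ⟨x, y, hxy, rfl⟩ := Finset.card_eq_two.1 hc
    have hx := hs (show x ∈ ({x, y} : Finset Pt) by simp)
    have hy := hs (show y ∈ ({x, y} : Finset Pt) by simp)
    simp only [Finset.mem_insert, Finset.mem_singleton] at hx hy
    rcases hx with rfl | rfl | rfl <;> rcases hy with rfl | rfl | rfl <;>
      simp_all [Finset.pair_comm]
  · rintro (rfl | rfl | rfl)
    · exact ⟨by simp, Finset.card_pair hab⟩
    · exact ⟨by intro x; simp; tauto, Finset.card_pair hza⟩
    · exact ⟨by intro x; simp; tauto, Finset.card_pair hzb⟩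

/-- A point of a triangle where one barycentric coordinate vanishes lies on an edge. -/
lemma mem_edge_of_cross_eq_zero {z a b : Pt} (h : cross (a - z) (b - z) ≠ 0) {x : Pt}
    (hx : x ∈ hull {z, a, b}) (h0 : cross (b - a) (x - a) = 0) : x ∈ hull {a, b} := by
  rw [hull_triple] at hx
  obtain ⟨s, t, hs, ht, hst, rfl⟩ := hx
  have h1 : s + t = 1 := by
    have : (1 - (s + t)) * cross (a - z) (b - z) = 0 := by
      rw [← h0]; simp [cross]; ring
    rcases mul_eq_zero.1 this with h2 | h2
    · linarith
    · exact absurd h2 h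
  rw [hull_pair]
  refine ⟨s, t, hs, ht, h1, ?_⟩
  have : s = 1 - t := by linarith
  subst this
  module

/-- Segments of a triangle through an interior point of an edge are contained in that edge. -/
lemma segment_subset_edge {z a b x y : Pt} (h : cross (a - z) (b - z) ≠ 0)
    (hx : x ∈ hull {z, a, b}) (hy : y ∈ hull {z, a, b})
    (h0 : cross (b - a) (midpoint ℝ x y - a) = 0) : hull {x, y} ⊆ hull {a, b} := by
  have hx' := ((mem_hull_triple h x).1 hx).2.2
  have hy' := ((mem_hull_triple h y).1 hy).2.2
  have hs : cross (b - a) (x - a) / cross (a - z) (b - z) +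
      cross (b - a) (y - a) / cross (a - z) (b - z) = 0 := by
    have : cross (b - a) (x - a) + cross (b - a) (y - a) = 2 * cross (b - a) (midpoint ℝ x y - a) := by
      simp [cross, midpoint_eq_smul_add]; ring
    rw [← add_div, this, h0]; simp
  have hx0 : cross (b - a) (x - a) / cross (a - z) (b - z) = 0 := by linarith
  have hy0 : cross (b - a) (y - a) / cross (a - z) (b - z) = 0 := by linarith
  rw [div_eq_zero_iff] at hx0 hy0
  refine hull_subset_hull fun w hw => ?_
  simp only [Finset.mem_insert, Finset.mem_singleton] at hw
  rcases hw with rfl | rfl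
  · exact mem_edge_of_cross_eq_zero h hx (hx0.resolve_right h)
  · exact mem_edge_of_cross_eq_zero h hy (hy0.resolve_right h)

/-- A segment in a triangle is contained in an edge or has its midpoint in the interior. -/
lemma IsTriangle.segment_subset_edge_or {K : Finset Pt} (hK : IsTriangle K) {x y : Pt}
    (hx : x ∈ hull K) (hy : y ∈ hull K) :
    (∃ E ∈ edgesOf K, hull {x, y} ⊆ hull E) ∨ midpoint ℝ x y ∈ interior (hull K) := by
  obtain ⟨z, a, b, rfl, h⟩ := hK.exists_rep
  have hm : midpoint ℝ x y ∈ hull {z, a, b} := (convex_hull _).midpoint_mem hx hy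
  by_contra! hcon
  obtain ⟨h1, h2⟩ := hcon
  have k1 : cross (b - a) (midpoint ℝ x y - a) ≠ 0 := fun h0 =>
    h1 {a, b} ((edgesOf_triple h).2 (by simp)) (segment_subset_edge h hx hy h0)
  have k2 : cross (a - z) (midpoint ℝ x y - z) ≠ 0 := fun h0 => by
    have e : ({z, a, b} : Finset Pt) = {b, z, a} := by ext; simp; tauto
    have h' : cross (z - b) (a - b) ≠ 0 := by
      rw [← cross_apex]; exact h
    rw [e] at hx hy
    exact h1 {z, a} ((edgesOf_triple h).2 (by simp)) (segment_subset_edge h' hx hy h0)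
  have k3 : cross (b - z) (midpoint ℝ x y - z) ≠ 0 := fun h0 => by
    have e : ({z, a, b} : Finset Pt) = {a, z, b} := by ext; simp; tauto
    have h' : cross (z - a) (b - a) ≠ 0 := by rw [cross_rot]; simpa using h
    rw [e] at hx hy
    exact h1 {z, b} ((edgesOf_triple h).2 (by simp)) (segment_subset_edge h' hx hy h0)
  obtain ⟨m1, m2, m3⟩ := (mem_hull_triple h _).1 hm
  refine h2 (mem_interior_hull_triple h (lt_of_le_of_ne m1 ?_) (lt_of_le_of_ne m2 ?_)
    (lt_of_le_of_ne m3 ?_))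
  · refine (div_ne_zero ?_ h).symm
    intro h0; apply k3; rw [← neg_eq_zero, ← h0]; simp [cross]; ring
  · exact (div_ne_zero k2 h).symm
  · exact (div_ne_zero k1 h).symm

lemma IsTriangle.interior_nonempty {K : Finset Pt} (hK : IsTriangle K) :
    (interior (hull K)).Nonempty := by
  obtain ⟨z, a, b, rfl, h⟩ := hK.exists_rep
  have key : ∀ c d : ℝ, c = d / 3 → d ≠ 0 → 0 < c / d := by
    rintro c d rfl hd; rw [div_div_cancel_left' hd]; norm_num
  refine ⟨z + (1 / 3 : ℝ) • (a - z) + (1 / 3 : ℝ) • (b - z),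
    mem_interior_hull_triple h ?_ ?_ ?_⟩ <;> refine key _ _ ?_ h <;> simp [cross] <;> ring

lemma IsTriangle.closure_interior {K : Finset Pt} (hK : IsTriangle K) :
    closure (interior (hull K)) = hull K := by
  rw [(convex_hull K).closure_interior_eq_closure_of_nonempty_interior hK.interior_nonempty,
    (isClosed_hull K).closure_eq]

/-- Near the midpoint of an edge, directions to the side of the opposite vertex point into the
triangle. -/
lemma eventually_mem_hull {z a b w : Pt} (h : 0 < cross (b - a) (z - a))
    (hw : 0 < cross (b - a) w) :
    ∀ᶠ ε : ℝ in 𝓝[>] 0, midpoint ℝ a b + ε • w ∈ hull {z, a, b} := by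
  rw [cross_apex] at h
  have c1 : Continuous fun ε : ℝ => cross (midpoint ℝ a b + ε • w - z) (b - z) := by
    unfold cross; fun_prop
  have c2 : Continuous fun ε : ℝ => cross (a - z) (midpoint ℝ a b + ε • w - z) := by
    unfold cross; fun_prop
  have t1 : 0 < cross (midpoint ℝ a b + (0 : ℝ) • w - z) (b - z) := by
    have : cross (midpoint ℝ a b + (0 : ℝ) • w - z) (b - z) = cross (a - z) (b - z) / 2 := by
      simp [cross, midpoint_eq_smul_add]; ring
    rw [this]; linarith
  have t2 : 0 < cross (a - z) (midpoint ℝ a b + (0 : ℝ) • w - z) := by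
    have : cross (a - z) (midpoint ℝ a b + (0 : ℝ) • w - z) = cross (a - z) (b - z) / 2 := by
      simp [cross, midpoint_eq_smul_add]; ring
    rw [this]; linarith
  filter_upwards [nhdsWithin_le_nhds (c1.continuousAt.eventually (lt_mem_nhds t1)),
    nhdsWithin_le_nhds (c2.continuousAt.eventually (lt_mem_nhds t2)),
    self_mem_nhdsWithin] with ε h1 h2 h3
  refine (mem_hull_triple h.ne' _).2 ⟨by positivity, by positivity, ?_⟩
  have : cross (b - a) (midpoint ℝ a b + ε • w - a) = ε * cross (b - a) w := by
    simp [cross, midpoint_eq_smul_add]; ring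
  rw [this]
  have : 0 < ε := h3
  positivity

/-! ### The reference triangle and areas -/

/-- The reference triangle. -/
def refTri : Set Pt := {u | 0 ≤ u 0 ∧ 0 ≤ u 1 ∧ u 0 + u 1 ≤ 1}

/-- The linear map with columns `p` and `q`. -/
def colMap (p q : Pt) : Pt →L[ℝ] Pt :=
  (EuclideanSpace.proj 0 : Pt →L[ℝ] ℝ).smulRight p + (EuclideanSpace.proj 1 : Pt →L[ℝ] ℝ).smulRight q

lemma colMap_apply (p q u : Pt) : colMap p q u = u 0 • p + u 1 • q := by
  simp [colMap]

lemma det_colMap (p q : Pt) : (colMap p q).det = cross p q := by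
  rw [ContinuousLinearMap.det, ← LinearMap.det_toMatrix (EuclideanSpace.basisFun (Fin 2) ℝ).toBasis,
    Matrix.det_fin_two]
  simp [LinearMap.toMatrix_apply, colMap_apply, cross]
  ring

/-- The affine map from the reference triangle to a triangle. -/
def affMap (z p q : Pt) (u : Pt) : Pt := z + colMap p q u

lemma hull_eq_image (z a b : Pt) : hull {z, a, b} = affMap z (a - z) (b - z) '' refTri := by
  rw [hull_triple]
  ext x
  simp only [mem_ofPred_eq, mem_image, refTri, affMap, colMap_apply]
  constructor
  · rintro ⟨s, t, hs, ht, hst, rfl⟩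
    exact ⟨!₂[s, t], ⟨by simpa, by simpa, by simpa⟩, by simp [add_assoc]⟩
  · rintro ⟨u, ⟨h0, h1, h2⟩, rfl⟩
    exact ⟨u 0, u 1, h0, h1, h2, by simp [add_assoc]⟩

lemma hasFDerivAt_affMap (z p q u : Pt) : HasFDerivAt (affMap z p q) (colMap p q) u :=
  (colMap p q).hasFDerivAt.const_add z

lemma affMap_injective {z p q : Pt} (h : cross p q ≠ 0) : Function.Injective (affMap z p q) := by
  intro u v huv
  have h1 : colMap p q (u - v) = 0 := by
    rw [map_sub, sub_eq_zero]; simpa [affMap] using huv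
  rw [colMap_apply] at h1
  have e0 := congrArg (fun x : Pt => x 0) h1
  have e1 := congrArg (fun x : Pt => x 1) h1
  simp at e0 e1
  apply pt_ext
  · have : (u 0 - v 0) * cross p q = 0 := by
      rw [cross]; linear_combination q 1 * e0 - q 0 * e1
    rcases mul_eq_zero.1 this with h2 | h2
    · linarith
    · exact absurd h2 h
  · have : (u 1 - v 1) * cross p q = 0 := by
      rw [cross]; linear_combination p 0 * e1 - p 1 * e0
    rcases mul_eq_zero.1 this with h2 | h2
    · linarith
    · exact absurd h2 h

lemma isClosed_refTri : IsClosed refTri := by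
  have h0 := continuous_coord 0
  have h1 := continuous_coord 1
  exact (isClosed_le continuous_const h0).inter
    ((isClosed_le continuous_const h1).inter (isClosed_le (h0.add h1) continuous_const))

lemma isCompact_refTri : IsCompact refTri := by
  refine Metric.isCompact_of_isClosed_isBounded isClosed_refTri
    ((Metric.isBounded_closedBall (x := (0 : Pt)) (r := 2)).subset fun u hu => ?_)
  obtain ⟨h0, h1, h2⟩ := hu
  rw [mem_closedBall_zero_iff]
  apply le_of_sq_le_sq _ (by norm_num)
  rw [norm_sq_pt]; nlinarith

/-- A nonempty open set of the plane contained in the reference triangle. -/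
lemma refTri_nhds : {u : Pt | 0 < u 0 ∧ 0 < u 1 ∧ u 0 + u 1 < 1} ⊆ refTri :=
  fun _ h => ⟨h.1.le, h.2.1.le, h.2.2.le⟩

lemma isOpen_refTri_interior : IsOpen {u : Pt | 0 < u 0 ∧ 0 < u 1 ∧ u 0 + u 1 < 1} := by
  have h0 := continuous_coord 0
  have h1 := continuous_coord 1
  exact (isOpen_lt continuous_const h0).inter
    ((isOpen_lt continuous_const h1).inter (isOpen_lt (h0.add h1) continuous_const))

/-- The area of the reference triangle. -/
def refArea : ℝ := volume.real refTri

lemma refArea_pos : 0 < refArea := by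
  refine ENNReal.toReal_pos ?_ isCompact_refTri.measure_lt_top.ne
  refine (lt_of_lt_of_le (isOpen_refTri_interior.measure_pos volume
    ⟨!₂[1 / 3, 1 / 3], ?_⟩) (measure_mono refTri_nhds)).ne'
  simp; norm_num

lemma setIntegral_hull {z a b : Pt} (h : cross (a - z) (b - z) ≠ 0) (g : Pt → ℝ) :
    ∫ x in hull {z, a, b}, g x =
      |cross (a - z) (b - z)| * ∫ u in refTri, g (affMap z (a - z) (b - z) u) := by
  rw [hull_eq_image, integral_image_eq_integral_abs_det_fderiv_smul volume
    isClosed_refTri.measurableSet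
    (fun u _ => (hasFDerivAt_affMap z (a - z) (b - z) u).hasFDerivWithinAt)
    (affMap_injective h).injOn g, det_colMap, ← integral_const_mul]
  rfl

lemma area_triple {z a b : Pt} (h : cross (a - z) (b - z) ≠ 0) :
    area {z, a, b} = |cross (a - z) (b - z)| * refArea := by
  have := setIntegral_hull h (fun _ => 1)
  simpa [area, refArea] using this

lemma IsTriangle.area_pos {K : Finset Pt} (hK : IsTriangle K) : 0 < area K := by
  obtain ⟨z, a, b, rfl, h⟩ := hK.exists_rep
  rw [area_triple h]
  exact mul_pos (abs_pos.2 h) refArea_pos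

lemma interior_hull_ae_eq (K : Finset Pt) : interior (hull K) =ᵐ[volume] hull K := by
  refine (interior_subset.eventuallyLE).antisymm ?_
  rw [ae_le_set]
  refine measure_mono_null ?_ ((convex_hull K).addHaar_frontier volume)
  rw [(isClosed_hull K).frontier_eq]

/-! ### Shape regularity -/

/-- The squared side lengths of the triangle are bounded by `σ` times its area. -/
def ShapeBound (σ : ℝ) (K : Finset Pt) : Prop :=
  ∀ x ∈ K, ∀ y ∈ K, dist x y ^ 2 ≤ σ * area K

/-- The sum of the squared lengths of the two edges at the newest vertex, in relation to the area.
This quantity does not change in newest vertex bisections. -/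
def NewestBound (κ : ℝ) (K E : Finset Pt) : Prop :=
  ∃ z a b, K = {z, a, b} ∧ E = {a, b} ∧ cross (a - z) (b - z) ≠ 0 ∧
    ‖a - z‖ ^ 2 + ‖b - z‖ ^ 2 ≤ κ * |cross (a - z) (b - z)|

lemma NewestBound.shapeBound {κ : ℝ} {K E : Finset Pt} (h : NewestBound κ K E) :
    ShapeBound (2 * κ / refArea) K := by
  obtain ⟨z, a, b, rfl, -, h0, hκ⟩ := h
  rw [ShapeBound, area_triple h0]
  have e : 2 * κ / refArea * (|cross (a - z) (b - z)| * refArea) =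
    2 * (κ * |cross (a - z) (b - z)|) := by field_simp [refArea_pos.ne']
  rw [e]
  have hab : ‖a - b‖ ^ 2 ≤ 2 * (‖a - z‖ ^ 2 + ‖b - z‖ ^ 2) := by
    have : a - b = (a - z) - (b - z) := by abel
    rw [this]
    have := parallelogram_law_with_norm ℝ (a - z) (b - z)
    nlinarith [sq_nonneg ‖a - z + (b - z)‖]
  have p1 := sq_nonneg ‖a - z‖
  have p2 := sq_nonneg ‖b - z‖
  intro x hx y hy
  simp only [Finset.mem_insert, Finset.mem_singleton] at hx hy
  rw [dist_eq_norm]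
  rcases hx with rfl | rfl | rfl <;> rcases hy with rfl | rfl | rfl <;>
    first
    | (simp only [sub_self, norm_zero]; nlinarith)
    | nlinarith
    | (rw [norm_sub_rev]; nlinarith)

lemma cross_midpoint_left (z a b : Pt) :
    cross (z - midpoint ℝ a b) (a - midpoint ℝ a b) = cross (a - z) (b - z) / 2 := by
  simp [cross, midpoint_eq_smul_add]; ring

lemma cross_midpoint_right (z a b : Pt) :
    cross (z - midpoint ℝ a b) (b - midpoint ℝ a b) = -cross (a - z) (b - z) / 2 := by
  simp [cross, midpoint_eq_smul_add]; ring

lemma NewestBound.bisect {κ : ℝ} {z a b m : Pt} (hm : m = midpoint ℝ a b)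
    (h : NewestBound κ {z, a, b} {a, b}) :
    cross (a - z) (b - z) ≠ 0 ∧ NewestBound κ {m, z, a} {z, a} ∧ NewestBound κ {m, z, b} {z, b} := by
  have key : cross (a - z) (b - z) ≠ 0 ∧
      ‖a - z‖ ^ 2 + ‖b - z‖ ^ 2 ≤ κ * |cross (a - z) (b - z)| := by
    obtain ⟨z', a', b', h1, h2, h3, h4⟩ := h
    have hab' : a' ≠ b' := by rintro rfl; exact h3 (cross_self _)
    have hza' : z' ≠ a' := by rintro rfl; exact h3 (by simp [cross])
    have hzb' : z' ≠ b' := by rintro rfl; exact h3 (by simp [cross])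
    have ha : a = a' ∨ a = b' := by
      have : a ∈ ({a', b'} : Finset Pt) := by rw [← h2]; simp
      simpa using this
    have hb : b = a' ∨ b = b' := by
      have : b ∈ ({a', b'} : Finset Pt) := by rw [← h2]; simp
      simpa using this
    have ha' : a' = a ∨ a' = b := by
      have : a' ∈ ({a, b} : Finset Pt) := by rw [h2]; simp
      simpa using this
    have hb' : b' = a ∨ b' = b := by
      have : b' ∈ ({a, b} : Finset Pt) := by rw [h2]; simp
      simpa using this
    have hz : z' = z ∨ z' = a ∨ z' = b := by
      have : z' ∈ ({z, a, b} : Finset Pt) := by rw [h1]; simp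
      simpa using this
    have hz' : z' = z := by
      rcases hz with h | h | h
      · exact h
      · rcases ha with h' | h' <;> simp_all
      · rcases hb with h' | h' <;> simp_all
    subst hz'
    rcases ha with rfl | rfl
    · have : b' = b := by
        rcases hb with rfl | rfl
        · rcases hb' with h | h <;> simp_all
        · rfl
      subst this
      exact ⟨h3, h4⟩
    · have : a' = b := by
        rcases hb with rfl | rfl
        · rfl
        · rcases ha' with h | h <;> simp_all
      subst this
      rw [cross_swap_apex, abs_neg]
      exact ⟨by simpa using h3, by linarith⟩
  obtain ⟨h0, hκ⟩ := key
  have c1 : cross (z - m) (a - m) = cross (a - z) (b - z) / 2 := by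
    rw [hm, cross_midpoint_left]
  have c2 : cross (z - m) (b - m) = -cross (a - z) (b - z) / 2 := by
    rw [hm, cross_midpoint_right]
  have n1 : ‖z - m‖ ^ 2 + ‖a - m‖ ^ 2 = (‖a - z‖ ^ 2 + ‖b - z‖ ^ 2) / 2 := by
    subst hm; simp only [norm_sq_pt]; simp [midpoint_eq_smul_add]; ring
  have n2 : ‖z - m‖ ^ 2 + ‖b - m‖ ^ 2 = (‖a - z‖ ^ 2 + ‖b - z‖ ^ 2) / 2 := by
    subst hm; simp only [norm_sq_pt]; simp [midpoint_eq_smul_add]; ring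
  refine ⟨h0, ⟨m, z, a, rfl, rfl, ?_, ?_⟩, ⟨m, z, b, rfl, rfl, ?_, ?_⟩⟩
  · rw [c1]; simpa using h0
  · rw [n1, c1, abs_div]; norm_num; linarith
  · rw [c2]; simpa using h0
  · rw [n2, c2, abs_div, abs_neg]; norm_num; linarith

lemma area_bisect {z a b m : Pt} (hm : m = midpoint ℝ a b) (h : cross (a - z) (b - z) ≠ 0) :
    area {m, z, a} = area {z, a, b} / 2 ∧ area {m, z, b} = area {z, a, b} / 2 := by
  have c1 : cross (z - m) (a - m) = cross (a - z) (b - z) / 2 := by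
    rw [hm, cross_midpoint_left]
  have c2 : cross (z - m) (b - m) = -cross (a - z) (b - z) / 2 := by
    rw [hm, cross_midpoint_right]
  rw [area_triple h, area_triple (by rw [c1]; simpa using h),
    area_triple (by rw [c2]; simpa using h), c1, c2, abs_div, abs_div, abs_neg]
  norm_num
  ring

/-- The two halves of a bisected triangle cover it. -/
lemma hull_bisect {z a b m : Pt} (hm : m = midpoint ℝ a b) :
    hull {z, a, b} = hull {m, z, a} ∪ hull {m, z, b} := by
  have hmem : m ∈ hull {z, a, b} := by
    rw [hm]
    exact (convex_hull _).midpoint_mem (mem_hull_of_mem (by simp)) (mem_hull_of_mem (by simp))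
  apply Subset.antisymm
  · intro x hx
    rw [hull_triple] at hx
    obtain ⟨s, t, hs, ht, hst, rfl⟩ := hx
    rcases le_total t s with h | h
    · left
      rw [hull_triple]
      refine ⟨1 - s - t, s - t, by linarith, by linarith, by linarith, ?_⟩
      subst hm
      apply pt_ext <;> simp [midpoint_eq_smul_add] <;> ring
    · right
      rw [hull_triple]
      refine ⟨1 - s - t, t - s, by linarith, by linarith, by linarith, ?_⟩
      subst hm
      apply pt_ext <;> simp [midpoint_eq_smul_add] <;> ring
  · apply union_subset <;> refine hull_subset_hull fun x hx => ?_ <;>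
      simp only [Finset.mem_insert, Finset.mem_singleton] at hx <;>
      rcases hx with rfl | rfl | rfl <;>
      first | exact hmem | exact mem_hull_of_mem (by simp)

/-- The squared diameter of the inscribed disc is bounded by the area. -/
lemma exists_inDiam_sq_le : ∃ C : ℝ, 0 < C ∧ ∀ K : Finset Pt, IsTriangle K →
    0 < inDiam K ∧ inDiam K ^ 2 ≤ C * area K := by
  set ω : ℝ := volume.real (Metric.ball (0 : Pt) 1) with hω
  have hω0 : 0 < ω := by
    refine ENNReal.toReal_pos (Metric.measure_ball_pos volume _ one_pos).ne'
      measure_ball_lt_top.ne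
  refine ⟨4 / ω, by positivity, fun K hK => ?_⟩
  have hbd : ∀ d ∈ {d : ℝ | 0 ≤ d ∧ ∃ c : Pt, Metric.closedBall c (d / 2) ⊆ hull K},
      d ≤ √(4 / ω * area K) := by
    rintro d ⟨hd, c, hc⟩
    apply Real.le_sqrt_of_sq_le
    have h1 : volume.real (Metric.closedBall c (d / 2)) ≤ area K :=
      measureReal_mono hc (isCompact_hull K).measure_lt_top.ne
    rw [Measure.addHaar_real_closedBall volume c (by positivity)] at h1
    have h2 : Module.finrank ℝ Pt = 2 := by simp
    rw [h2, ← hω] at h1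
    rw [div_mul_eq_mul_div, le_div_iff₀ hω0]
    nlinarith
  obtain ⟨x, hx⟩ := hK.interior_nonempty
  obtain ⟨ε, hε, hball⟩ := Metric.mem_nhds_iff.1 (mem_interior_iff_mem_nhds.1 hx)
  have hmem : ε ∈ {d : ℝ | 0 ≤ d ∧ ∃ c : Pt, Metric.closedBall c (d / 2) ⊆ hull K} :=
    ⟨hε.le, x, (Metric.closedBall_subset_ball (by linarith)).trans hball⟩
  have h1 : ε ≤ inDiam K := le_csSup ⟨_, hbd⟩ hmem
  have h2 : inDiam K ≤ √(4 / ω * area K) := csSup_le ⟨_, hmem⟩ hbd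
  refine ⟨by linarith, ?_⟩
  calc inDiam K ^ 2 ≤ √(4 / ω * area K) ^ 2 := by
        apply pow_le_pow_left₀ (by linarith) h2
    _ = 4 / ω * area K := Real.sq_sqrt (by have := hK.area_pos; positivity)

lemma exists_newestBound_of_shapeRegularity (γ : ℝ) : ∃ κ : ℝ, 0 < κ ∧
    ∀ (Ω : Set Pt) (M : LabelledMesh), IsInitialMesh Ω M → shapeRegularity M.tri ≤ γ →
      ∀ K ∈ M.tri, NewestBound κ K (M.refEdge K) := by
  obtain ⟨C, hC, hin⟩ := exists_inDiam_sq_le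
  refine ⟨2 * γ ^ 2 * C * refArea + 1, by have := refArea_pos; positivity,
    fun Ω M hM hγ K hK => ?_⟩
  have hT := hM.isTriangulation.isTriangle K hK
  obtain ⟨a, b, -, hab⟩ := exists_pair_of_mem_edgesOf (hM.refEdge_mem K hK)
  obtain ⟨z, hz, -, h0⟩ := hT.exists_apex (hM.refEdge_mem K hK) hab
  refine ⟨z, a, b, hz, hab, h0, ?_⟩
  obtain ⟨hpos, hle⟩ := hin K hT
  have h1 : Metric.diam (hull K) / inDiam K ≤ γ :=
    (le_csSup (M.tri.finite_toSet.image _).bddAbove (mem_image_of_mem _ hK)).trans hγ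
  rw [div_le_iff₀ hpos] at h1
  have h2 : Metric.diam (hull K) ^ 2 ≤ γ ^ 2 * (C * area K) := by
    calc Metric.diam (hull K) ^ 2 ≤ (γ * inDiam K) ^ 2 :=
          pow_le_pow_left₀ Metric.diam_nonneg h1 2
      _ = γ ^ 2 * inDiam K ^ 2 := by ring
      _ ≤ _ := by gcongr
  have hd : ∀ x ∈ K, ∀ y ∈ K, ‖x - y‖ ^ 2 ≤ γ ^ 2 * (C * area K) := fun x hx y hy => by
    refine le_trans (pow_le_pow_left₀ (norm_nonneg _) ?_ 2) h2
    rw [← dist_eq_norm]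
    exact Metric.dist_le_diam_of_mem (isCompact_hull K).isBounded (mem_hull_of_mem hx)
      (mem_hull_of_mem hy)
  have e1 := hd a (by rw [hz]; simp) z (by rw [hz]; simp)
  have e2 := hd b (by rw [hz]; simp) z (by rw [hz]; simp)
  rw [hz, area_triple h0] at e1 e2
  have := abs_nonneg (cross (a - z) (b - z))
  nlinarith

/-! ### Refinements -/

/-- Every triangle of `T'` either belongs to `T` or is contained in a triangle of `T` of at least
twice its area, and every triangle of `T` is covered by the triangles of `T'` it contains. -/
structure Refines (T T' : Finset (Finset Pt)) : Prop where
  parent : ∀ K' ∈ T', ∃ K ∈ T, hull K' ⊆ hull K ∧ (K' = K ∨ area K' ≤ area K / 2)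
  cover : ∀ K ∈ T, ∀ x ∈ hull K, ∃ K' ∈ T', hull K' ⊆ hull K ∧ x ∈ hull K'

lemma area_nonneg (K : Finset Pt) : 0 ≤ area K := measureReal_nonneg

lemma Refines.trans {T T' T'' : Finset (Finset Pt)} (h : Refines T T') (h' : Refines T' T'') :
    Refines T T'' := by
  constructor
  · intro K'' hK''
    obtain ⟨K', hK', hs', ha'⟩ := h'.parent K'' hK''
    obtain ⟨K, hK, hs, ha⟩ := h.parent K' hK'
    refine ⟨K, hK, hs'.trans hs, ?_⟩
    rcases ha' with rfl | ha'
    · exact ha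
    · right
      rcases ha with rfl | ha
      · exact ha'
      · have := area_nonneg K'
        have := area_nonneg K
        linarith
  · intro K hK x hx
    obtain ⟨K', hK', hs, hx'⟩ := h.cover K hK x hx
    obtain ⟨K'', hK'', hs', hx''⟩ := h'.cover K' hK' x hx'
    exact ⟨K'', hK'', hs'.trans hs, hx''⟩

lemma Refines.refl (T : Finset (Finset Pt)) : Refines T T :=
  ⟨fun K hK => ⟨K, hK, Subset.rfl, Or.inl rfl⟩, fun K hK _ hx => ⟨K, hK, Subset.rfl, hx⟩⟩

lemma NVBStep.refines {κ : ℝ} {M M' : LabelledMesh} (h : NVBStep M M')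
    (hκ : ∀ K ∈ M.tri, NewestBound κ K (M.refEdge K)) :
    Refines M.tri M'.tri ∧ ∀ K ∈ M'.tri, NewestBound κ K (M'.refEdge K) := by
  obtain ⟨z, a, b, m, hm, hK, hE, htri, hr1, hr2, hr⟩ := h
  have h0 := hκ _ hK
  rw [hE] at h0
  obtain ⟨hc, n1, n2⟩ := h0.bisect hm
  obtain ⟨a1, a2⟩ := area_bisect hm hc
  have hh := hull_bisect (z := z) hm
  have s1 : hull {m, z, a} ⊆ hull {z, a, b} := by rw [hh]; exact subset_union_left
  have s2 : hull {m, z, b} ⊆ hull {z, a, b} := by rw [hh]; exact subset_union_right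
  have hmem : ∀ L, L ∈ M'.tri ↔ (L ≠ {z, a, b} ∧ L ∈ M.tri) ∨ L = {m, z, a} ∨ L = {m, z, b} := by
    intro L; rw [htri]; simp; tauto
  refine ⟨⟨fun L hL => ?_, fun K hK' x hx => ?_⟩, fun L hL => ?_⟩
  · rcases (hmem L).1 hL with ⟨-, h⟩ | rfl | rfl
    · exact ⟨L, h, Subset.rfl, Or.inl rfl⟩
    · exact ⟨_, hK, s1, Or.inr a1.le⟩
    · exact ⟨_, hK, s2, Or.inr a2.le⟩
  · by_cases hKe : K = {z, a, b}
    · subst hKe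
      rw [hh] at hx
      rcases hx with hx | hx
      · exact ⟨_, (hmem _).2 (by simp), s1, hx⟩
      · exact ⟨_, (hmem _).2 (by simp), s2, hx⟩
    · exact ⟨K, (hmem _).2 (Or.inl ⟨hKe, hK'⟩), Subset.rfl, hx⟩
  · rcases (hmem L).1 hL with ⟨h, h'⟩ | rfl | rfl
    · rw [hr L h' h]; exact hκ L h'
    · rw [hr1]; exact n1
    · rw [hr2]; exact n2

lemma refines_of_reflTransGen {κ : ℝ} {M M' : LabelledMesh}
    (h : Relation.ReflTransGen NVBStep M M')
    (hκ : ∀ K ∈ M.tri, NewestBound κ K (M.refEdge K)) :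
    Refines M.tri M'.tri ∧ ∀ K ∈ M'.tri, NewestBound κ K (M'.refEdge K) := by
  induction h with
  | refl => exact ⟨Refines.refl _, hκ⟩
  | tail _ hs ih =>
    obtain ⟨h1, h2⟩ := hs.refines ih.2
    exact ⟨ih.1.trans h1, h2⟩

/-! ### Conforming meshes -/

lemma mem_edgesOf {K E : Finset Pt} : E ∈ edgesOf K ↔ E ⊆ K ∧ E.card = 2 :=
  Finset.mem_powersetCard

lemma IsTriangle.hull_inter {K A B : Finset Pt} (hK : IsTriangle K) (hA : A ⊆ K) (hB : B ⊆ K) :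
    hull (A ∩ B) = hull A ∩ hull B := by
  have := hK.2.convexHull_inter hA hB
  rwa [← Finset.coe_inter] at this

lemma IsTriangle.pair_subset_of_openSegment {K A : Finset Pt} {a b x : Pt} (hK : IsTriangle K)
    (hA : A ⊆ K) (hab : {a, b} ⊆ K) (hne : a ≠ b) (hx : x ∈ openSegment ℝ a b) (hxA : x ∈ hull A) :
    {a, b} ⊆ A := by
  have hxE : x ∈ hull {a, b} := by rw [hull_pair]; exact openSegment_subset_segment _ _ _ hx
  have hxI : x ∈ hull (A ∩ {a, b}) := by rw [hK.hull_inter hA hab]; exact ⟨hxA, hxE⟩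
  have hsingle : ∀ c : Pt, hull {c} = {c} := fun c => by simp [hull]
  intro c hc
  by_contra hcA
  simp only [Finset.mem_insert, Finset.mem_singleton] at hc
  rcases hc with rfl | rfl
  · have : A ∩ {c, b} ⊆ {b} := by
      intro y hy
      simp only [Finset.mem_inter, Finset.mem_insert, Finset.mem_singleton] at hy ⊢
      rcases hy with ⟨h1, rfl | rfl⟩
      · exact absurd h1 hcA
      · rfl
    have hxb : x = b := by simpa [hsingle] using hull_mono this hxI
    subst hxb
    exact hne (right_mem_openSegment_iff.1 hx)
  · have : A ∩ {a, c} ⊆ {a} := by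
      intro y hy
      simp only [Finset.mem_inter, Finset.mem_insert, Finset.mem_singleton] at hy ⊢
      rcases hy with ⟨h1, rfl | rfl⟩
      · rfl
      · exact absurd h1 hcA
    have hxa : x = a := by simpa [hsingle] using hull_mono this hxI
    subst hxa
    exact hne (left_mem_openSegment_iff.1 hx)


lemma IsTriangulation.pair_subset (hT : IsTriangulation Ω T) {K L : Finset Pt} (hK : K ∈ T)
    (hL : L ∈ T) {a b x : Pt} (hab : {a, b} ⊆ K) (hne : a ≠ b) (hx : x ∈ openSegment ℝ a b)
    (hxL : x ∈ hull L) : {a, b} ⊆ L := by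
  have hxK : x ∈ hull K := hull_mono hab (by
    rw [hull_pair]; exact openSegment_subset_segment _ _ _ hx)
  have : x ∈ hull (K ∩ L) := by rw [← hT.conforming K hK L hL]; exact ⟨hxK, hxL⟩
  exact ((hT.isTriangle K hK).pair_subset_of_openSegment Finset.inter_subset_left hab hne hx
    this).trans Finset.inter_subset_right

lemma midpoint_mem_openSegment (a b : Pt) : midpoint ℝ a b ∈ openSegment ℝ a b :=
  ⟨1 / 2, 1 / 2, by norm_num, by norm_num, by norm_num, by rw [midpoint_eq_smul_add, invOf_eq_inv]; module⟩

/-- If points arbitrarily close to the midpoint of an edge in direction `w` are covered by `S`,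
then some triangle of `S` has this edge and contains such points. -/
lemma IsTriangulation.exists_adjacent (hT : IsTriangulation Ω T) {K : Finset Pt} (hK : K ∈ T)
    {a b w : Pt} (hab : {a, b} ⊆ K) (hne : a ≠ b) {S : Finset (Finset Pt)} (hS : S ⊆ T)
    (h : ∃ᶠ ε : ℝ in 𝓝[>] 0, ∃ L ∈ S, midpoint ℝ a b + ε • w ∈ hull L) :
    ∃ L ∈ S, {a, b} ⊆ L ∧ ∃ ε : ℝ, 0 < ε ∧ midpoint ℝ a b + ε • w ∈ hull L := by
  have h1 : ∃ L ∈ S, ∃ᶠ ε : ℝ in 𝓝[>] 0, midpoint ℝ a b + ε • w ∈ hull L := by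
    by_contra! hcon
    apply h
    filter_upwards [(Finset.eventually_all S).2 hcon] with ε hε
    rintro ⟨L, hL, hmem⟩
    exact hε L hL hmem
  obtain ⟨L, hL, hf⟩ := h1
  have hm : midpoint ℝ a b ∈ hull L := by
    have hc : Tendsto (fun ε : ℝ => midpoint ℝ a b + ε • w) (𝓝[>] 0) (𝓝 (midpoint ℝ a b)) := by
      have : Continuous fun ε : ℝ => midpoint ℝ a b + ε • w := by fun_prop
      simpa using (this.tendsto 0).mono_left nhdsWithin_le_nhds
    exact (isClosed_hull L).mem_of_frequently_of_tendsto hf hc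
  refine ⟨L, hL, hT.pair_subset hK (hS hL) hab hne (midpoint_mem_openSegment a b) hm, ?_⟩
  obtain ⟨ε, h1, h2⟩ := (hf.and_eventually self_mem_nhdsWithin).exists
  exact ⟨ε, h2, h1⟩

/-- At most one triangle lies on each side of an edge. -/
lemma IsTriangulation.eq_of_same_side (hT : IsTriangulation Ω T) {z₁ z₂ a b : Pt}
    (h₁ : ({z₁, a, b} : Finset Pt) ∈ T) (h₂ : ({z₂, a, b} : Finset Pt) ∈ T)
    (h : 0 < cross (b - a) (z₁ - a) * cross (b - a) (z₂ - a)) :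
    ({z₁, a, b} : Finset Pt) = {z₂, a, b} := by
  wlog hpos : 0 < cross (b - a) (z₁ - a) generalizing a b
  · have hs : ∀ z, cross (a - b) (z - b) = -cross (b - a) (z - a) := fun z => by
      simp [cross]; ring
    have e : ∀ z, ({z, a, b} : Finset Pt) = {z, b, a} := fun z => by rw [Finset.pair_comm]
    have hneg : cross (b - a) (z₁ - a) < 0 := by
      refine lt_of_le_of_ne (not_lt.1 hpos) fun h0 => ?_
      rw [h0, zero_mul] at h; exact lt_irrefl _ h
    rw [e, e] at *
    exact this h₁ h₂ (by rw [hs, hs, neg_mul_neg]; exact h) (by rw [hs]; linarith)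
  have hpos₂ : 0 < cross (b - a) (z₂ - a) := (mul_pos_iff_of_pos_left hpos).1 h
  by_contra hne
  obtain ⟨ε, ⟨m₁, m₂⟩, hε⟩ := (((eventually_mem_hull hpos hpos).and
    (eventually_mem_hull hpos₂ hpos)).and self_mem_nhdsWithin).exists
  have hz : z₁ ≠ z₂ := by rintro rfl; exact hne rfl
  have hI : ({z₁, a, b} ∩ {z₂, a, b} : Finset Pt) ⊆ {a, b} := by
    intro y hy
    simp only [Finset.mem_inter, Finset.mem_insert, Finset.mem_singleton] at hy ⊢
    rcases hy with ⟨rfl | h | h, h'⟩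
    · rcases h' with h' | h'
      · exact absurd h' hz
      · exact h'
    · exact Or.inl h
    · exact Or.inr h
  have hm : midpoint ℝ a b + ε • (z₁ - a) ∈ hull {a, b} := by
    refine hull_mono hI ?_
    rw [← hT.conforming _ h₁ _ h₂]
    exact ⟨m₁, m₂⟩
  rw [hull_pair] at hm
  obtain ⟨s, t, -, -, hst, he⟩ := hm
  have h0 : cross (b - a) (midpoint ℝ a b + ε • (z₁ - a) - a) = ε * cross (b - a) (z₁ - a) := by
    simp [cross, midpoint_eq_smul_add]; ring
  have hs : s = 1 - t := by linarith
  have h1 : cross (b - a) (midpoint ℝ a b + ε • (z₁ - a) - a) = 0 := by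
    rw [← he, hs]; simp [cross]; ring
  have : 0 < ε * cross (b - a) (z₁ - a) := mul_pos hε hpos
  linarith

lemma cross_eq_zero_of_mem_hull_pair {a b x : Pt} (hx : x ∈ hull {a, b}) :
    cross (b - a) (x - a) = 0 := by
  rw [hull_pair] at hx
  obtain ⟨s, t, -, -, hst, rfl⟩ := hx
  have hs : s = 1 - t := by linarith
  subst hs
  simp [cross]; ring

/-- Two triangles of a mesh with three common points that are not collinear are equal. -/
lemma IsTriangulation.eq_of_three_points (hT : IsTriangulation Ω T) {K L : Finset Pt}
    (hK : K ∈ T) (hL : L ∈ T) {w c d : Pt} (hw : w ∈ hull K ∩ hull L) (hc : c ∈ hull K ∩ hull L)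
    (hd : d ∈ hull K ∩ hull L) (h0 : cross (c - w) (d - w) ≠ 0) : K = L := by
  by_contra hne
  have hcard : ∀ J ∈ T, J.card = 3 := fun J hJ => (hT.isTriangle J hJ).1
  have hss : ¬ K ⊆ L := fun h =>
    hne (Finset.eq_of_subset_of_card_le h (by rw [hcard K hK, hcard L hL]))
  obtain ⟨z, hzK, hzL⟩ := Finset.not_subset.1 hss
  have hE : K.erase z ∈ edgesOf K := by
    rw [mem_edgesOf, Finset.card_erase_of_mem hzK, hcard K hK]
    exact ⟨Finset.erase_subset _ _, rfl⟩
  obtain ⟨a, b, hab, he⟩ := exists_pair_of_mem_edgesOf hE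
  have hI : hull K ∩ hull L ⊆ hull {a, b} := by
    rw [← he, hT.conforming K hK L hL]
    refine hull_mono fun y hy => ?_
    rw [Finset.mem_inter] at hy
    exact Finset.mem_erase.2 ⟨fun h => hzL (h ▸ hy.2), hy.1⟩
  have e1 := cross_eq_zero_of_mem_hull_pair (hI hw)
  have e2 := cross_eq_zero_of_mem_hull_pair (hI hc)
  have e3 := cross_eq_zero_of_mem_hull_pair (hI hd)
  apply h0
  have hba : (b - a) 0 ≠ 0 ∨ (b - a) 1 ≠ 0 := by
    by_contra! h
    exact hab (sub_eq_zero.1 (pt_ext h.1 h.2)).symm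
  have f1 : cross (b - a) (c - w) = 0 := by
    rw [← sub_eq_zero_of_eq (e2.trans e1.symm)]; simp [cross]; ring
  have f2 : cross (b - a) (d - w) = 0 := by
    rw [← sub_eq_zero_of_eq (e3.trans e1.symm)]; simp [cross]; ring
  generalize b - a = r at *
  generalize c - w = p at *
  generalize d - w = q at *
  simp only [cross] at *
  rcases hba with h | h
  · have : r 0 * (p 0 * q 1 - p 1 * q 0) = 0 := by linear_combination p 0 * f2 - q 0 * f1
    exact (mul_eq_zero.1 this).resolve_left h
  · have : r 1 * (p 0 * q 1 - p 1 * q 0) = 0 := by linear_combination p 1 * f2 - q 1 * f1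
    exact (mul_eq_zero.1 this).resolve_left h

/-- Two triangles of a mesh containing a common triangle are equal. -/
lemma IsTriangulation.eq_of_hull_subset (hT : IsTriangulation Ω T) {K L K' : Finset Pt}
    (hK : K ∈ T) (hL : L ∈ T) (hK' : IsTriangle K') (h1 : hull K' ⊆ hull K)
    (h2 : hull K' ⊆ hull L) : K = L := by
  obtain ⟨w, c, d, rfl, h0⟩ := hK'.exists_rep
  have h := subset_inter h1 h2
  exact hT.eq_of_three_points hK hL (h (mem_hull_of_mem (by simp)))
    (h (mem_hull_of_mem (by simp))) (h (mem_hull_of_mem (by simp))) h0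

lemma IsTriangulation.disjoint_interior (hT : IsTriangulation Ω T) {K L : Finset Pt} (hK : K ∈ T)
    (hL : L ∈ T) (hne : K ≠ L) : Disjoint (interior (hull K)) (interior (hull L)) := by
  rw [Set.disjoint_iff_inter_eq_empty, ← interior_inter]
  by_contra h
  obtain ⟨x, hx⟩ := nonempty_iff_ne_empty.2 h
  have hev : ∀ w : Pt, ∀ᶠ ε : ℝ in 𝓝[>] 0, x + ε • w ∈ hull K ∩ hull L := fun w => by
    have hc : Tendsto (fun ε : ℝ => x + ε • w) (𝓝[>] 0) (𝓝 x) := by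
      have : Continuous fun ε : ℝ => x + ε • w := by fun_prop
      simpa using (this.tendsto 0).mono_left nhdsWithin_le_nhds
    exact hc.eventually (mem_interior_iff_mem_nhds.1 hx)
  obtain ⟨ε, ⟨h1, h2⟩, hε⟩ := (((hev !₂[1, 0]).and (hev !₂[0, 1])).and self_mem_nhdsWithin).exists
  refine hne (hT.eq_of_three_points hK hL (interior_subset hx) h1 h2 ?_)
  have : 0 < ε := hε
  simp [cross, this.ne']

lemma IsTriangulation.hull_inter_edges (hT : IsTriangulation Ω T) {K L E F : Finset Pt}
    (hK : K ∈ T) (hL : L ∈ T) (hE : E ∈ edgesOf K) (hF : F ∈ edgesOf L) :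
    hull E ∩ hull F ⊆ hull (E ∩ F) := by
  rintro x ⟨hxE, hxF⟩
  have hEK := (mem_edgesOf.1 hE).1
  have hFL := (mem_edgesOf.1 hF).1
  have h1 : x ∈ hull (K ∩ L) := by
    rw [← hT.conforming K hK L hL]; exact ⟨hull_mono hEK hxE, hull_mono hFL hxF⟩
  have h2 : x ∈ hull (E ∩ (K ∩ L)) := by
    rw [(hT.isTriangle K hK).hull_inter hEK Finset.inter_subset_left]; exact ⟨hxE, h1⟩
  have h3 : x ∈ hull ((E ∩ (K ∩ L)) ∩ F) := by
    rw [(hT.isTriangle L hL).hull_inter _ hFL]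
    · exact ⟨h2, hxF⟩
    · exact Finset.inter_subset_right.trans Finset.inter_subset_right
  refine hull_mono ?_ h3
  intro y hy
  simp only [Finset.mem_inter] at hy ⊢
  tauto

/-! ### Signed sums over the triangles adjacent to an edge -/

/-- The jump over `E` of a field which is given on each triangle separately. -/
def signedSum (T : Finset (Finset Pt)) (N : EdgeNumbering) (E : Finset Pt)
    (g : Finset Pt → Pt) : Pt :=
  ∑ K ∈ T.filter (fun K => E ∈ edgesOf K), if N.PointsInto E K then -(g K) else g K

lemma signedSum_add (T : Finset (Finset Pt)) (N : EdgeNumbering) (E : Finset Pt)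
    (g h : Finset Pt → Pt) :
    signedSum T N E (fun K => g K + h K) = signedSum T N E g + signedSum T N E h := by
  rw [signedSum, signedSum, signedSum, ← Finset.sum_add_distrib]
  refine Finset.sum_congr rfl fun K _ => ?_
  split_ifs
  · rw [neg_add]
  · rfl

lemma EdgeNumbering.IsFor.fst_ne_snd {N : EdgeNumbering} (hN : N.IsFor Ω T) {E : Finset Pt}
    (hE : E ∈ edges T) : N.fst E ≠ N.snd E := by
  obtain ⟨K, -, hEK⟩ := Finset.mem_biUnion.1 hE
  have hc := (mem_edgesOf.1 hEK).2
  rw [hN.ends E hE] at hc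
  intro h
  rw [h] at hc
  simp at hc

lemma EdgeNumbering.normal_inner (N : EdgeNumbering) (E : Finset Pt) (x : Pt) :
    ⟪N.normal E, x⟫ = (dist (N.fst E) (N.snd E))⁻¹ * cross (N.snd E - N.fst E) x := by
  rw [inner_pt, normal, tangent]
  simp [cross]; ring

lemma EdgeNumbering.pointsInto_iff (N : EdgeNumbering) {E K : Finset Pt} {z : Pt}
    (hne : N.fst E ≠ N.snd E) (hK : K = {z, N.fst E, N.snd E}) :
    N.PointsInto E K ↔ 0 < cross (N.snd E - N.fst E) (z - N.fst E) := by
  have hd : 0 < (dist (N.fst E) (N.snd E))⁻¹ := inv_pos.2 (dist_pos.2 hne)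
  simp only [PointsInto, normal_inner, hK, mul_pos_iff_of_pos_left hd]
  constructor
  · rintro ⟨w, hw, h⟩
    simp only [Finset.mem_insert, Finset.mem_singleton] at hw
    rcases hw with rfl | rfl | rfl
    · exact h
    · simp [cross] at h
    · rw [cross_self] at h; exact absurd h (lt_irrefl _)
  · intro h
    exact ⟨z, by simp, h⟩

lemma mem_edges {E : Finset Pt} : E ∈ edges T ↔ ∃ K ∈ T, E ∈ edgesOf K := by
  simp [edges]

lemma EdgeNumbering.IsFor.exists_apex {N : EdgeNumbering} (hN : N.IsFor Ω T)
    (hT : IsTriangulation Ω T) {E K : Finset Pt} (hK : K ∈ T) (hE : E ∈ edgesOf K) :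
    ∃ z, K = {z, N.fst E, N.snd E} ∧ cross (N.snd E - N.fst E) (z - N.fst E) ≠ 0 := by
  have hE' : E ∈ edges T := mem_edges.2 ⟨K, hK, hE⟩
  obtain ⟨z, h1, -, h2⟩ := (hT.isTriangle K hK).exists_apex hE (hN.ends E hE')
  exact ⟨z, h1, by rwa [cross_apex]⟩

/-- Two triangles with a common edge coincide if the normal points into both or none of them. -/
lemma IsTriangulation.eq_of_pointsInto_iff (hT : IsTriangulation Ω T) {N : EdgeNumbering}
    (hN : N.IsFor Ω T) {E K L : Finset Pt} (hK : K ∈ T) (hL : L ∈ T) (hEK : E ∈ edgesOf K)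
    (hEL : E ∈ edgesOf L) (h : N.PointsInto E K ↔ N.PointsInto E L) : K = L := by
  have hE' : E ∈ edges T := mem_edges.2 ⟨K, hK, hEK⟩
  have hne := hN.fst_ne_snd hE'
  obtain ⟨z, hz, h1⟩ := hN.exists_apex hT hK hEK
  obtain ⟨w, hw, h2⟩ := hN.exists_apex hT hL hEL
  rw [N.pointsInto_iff hne hz, N.pointsInto_iff hne hw] at h
  have hmul : 0 < cross (N.snd E - N.fst E) (z - N.fst E) *
      cross (N.snd E - N.fst E) (w - N.fst E) := by
    rcases lt_or_gt_of_ne h1 with h3 | h3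
    · have : ¬ 0 < cross (N.snd E - N.fst E) (w - N.fst E) := by
        rw [← h]; exact not_lt.2 h3.le
      exact mul_pos_of_neg_of_neg h3 (lt_of_le_of_ne (not_lt.1 this) h2)
    · exact mul_pos h3 (h.1 h3)
  rw [hz, hw]
  rw [hz] at hK
  rw [hw] at hL
  exact hT.eq_of_same_side hK hL hmul

lemma IsTriangulation.card_adjacent_le (hT : IsTriangulation Ω T) {N : EdgeNumbering}
    (hN : N.IsFor Ω T) (E : Finset Pt) :
    (T.filter (fun K => E ∈ edgesOf K)).card ≤ 2 := by
  have h : ∀ K ∈ T.filter (fun K => E ∈ edgesOf K), (decide (N.PointsInto E K)) ∈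
      (Finset.univ : Finset Bool) := fun _ _ => Finset.mem_univ _
  refine (Finset.card_le_card_of_injOn _ h ?_).trans (by simp)
  intro K hK L hL hKL
  simp only [Finset.coe_filter, mem_ofPred_eq] at hK hL
  exact hT.eq_of_pointsInto_iff hN hK.1 hL.1 hK.2 hL.2 (decide_eq_decide.1 hKL)

/-- The position of the vertex opposite to an edge, given a point of the triangle on one side. -/
lemma side_of_mem_hull {z a b w : Pt} {ε : ℝ} (hε : 0 < ε) (hw : 0 < cross (b - a) w)
    (h0 : cross (b - a) (z - a) ≠ 0) (hm : midpoint ℝ a b + ε • w ∈ hull {z, a, b}) :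
    0 < cross (b - a) (z - a) := by
  have h1 := ((mem_hull_triple (by rwa [← cross_apex]) _).1 hm).2.2
  rw [← cross_apex z a b] at h1
  have : cross (b - a) (midpoint ℝ a b + ε • w - a) = ε * cross (b - a) w := by
    simp [cross, midpoint_eq_smul_add]; ring
  rw [this] at h1
  by_contra hneg
  have : cross (b - a) (z - a) < 0 := lt_of_le_of_ne (not_lt.1 hneg) h0
  have := div_neg_of_pos_of_neg (mul_pos hε hw) this
  linarith

lemma side_of_mem_hull_neg {z a b w : Pt} {ε : ℝ} (hε : 0 < ε) (hw : cross (b - a) w < 0)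
    (h0 : cross (b - a) (z - a) ≠ 0) (hm : midpoint ℝ a b + ε • w ∈ hull {z, a, b}) :
    cross (b - a) (z - a) < 0 := by
  have hs : ∀ w, cross (a - b) w = -cross (b - a) w := fun w => by simp [cross]; ring
  have hs' : cross (a - b) (z - b) = -cross (b - a) (z - a) := by simp [cross]; ring
  rw [midpoint_comm, Finset.pair_comm] at hm
  have := side_of_mem_hull hε (by rw [hs]; linarith) (by rw [hs']; simpa using h0) hm
  linarith

/-- The jump vanishes if the field is the same on all triangles of a set that covers a
neighbourhood of the midpoint. -/
lemma IsTriangulation.signedSum_eq_zero (hT : IsTriangulation Ω T) {N : EdgeNumbering}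
    (hN : N.IsFor Ω T) {E : Finset Pt} (hE : E ∈ edges T) {S : Finset (Finset Pt)} (hS : S ⊆ T)
    (hcov : ∀ᶠ x in 𝓝 (midpoint ℝ (N.fst E) (N.snd E)), ∃ L ∈ S, x ∈ hull L)
    {g : Finset Pt → Pt} {c : Pt} (hg : ∀ L ∈ S, g L = c) : signedSum T N E g = 0 := by
  have hne := hN.fst_ne_snd hE
  have hEe := hN.ends E hE
  set a := N.fst E with ha
  set b := N.snd E with hb
  obtain ⟨K, hK, hEK⟩ := mem_edges.1 hE
  have habK : {a, b} ⊆ K := by rw [← hEe]; exact (mem_edgesOf.1 hEK).1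
  have hfreq : ∀ w : Pt, ∃ L ∈ S, {a, b} ⊆ L ∧ ∃ ε : ℝ, 0 < ε ∧
      midpoint ℝ a b + ε • w ∈ hull L := by
    intro w
    refine hT.exists_adjacent hK habK hne hS (Eventually.frequently ?_)
    have hc : Tendsto (fun ε : ℝ => midpoint ℝ a b + ε • w) (𝓝[>] 0) (𝓝 (midpoint ℝ a b)) := by
      have : Continuous fun ε : ℝ => midpoint ℝ a b + ε • w := by fun_prop
      simpa using (this.tendsto 0).mono_left nhdsWithin_le_nhds
    exact hc.eventually hcov
  set n : Pt := !₂[-((b - a) 1), (b - a) 0] with hn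
  have hcn : 0 < cross (b - a) n := by
    have h1 : cross (b - a) n = ‖b - a‖ ^ 2 := by
      rw [norm_sq_pt, cross, hn]; simp; ring
    rw [h1]
    have := norm_pos_iff.2 (sub_ne_zero.2 hne.symm)
    positivity
  have hcn' : cross (b - a) (-n) < 0 := by
    have : cross (b - a) (-n) = -cross (b - a) n := by simp [cross]; ring
    linarith
  have hmem : ∀ L ∈ S, {a, b} ⊆ L → E ∈ edgesOf L := fun L _ h =>
    mem_edgesOf.2 ⟨by rw [hEe]; exact h, (mem_edgesOf.1 hEK).2⟩
  obtain ⟨L₁, hL₁, hs₁, ε₁, hε₁, hm₁⟩ := hfreq n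
  obtain ⟨L₂, hL₂, hs₂, ε₂, hε₂, hm₂⟩ := hfreq (-n)
  obtain ⟨z₁, hz₁, h1⟩ := hN.exists_apex hT (hS hL₁) (hmem L₁ hL₁ hs₁)
  obtain ⟨z₂, hz₂, h2⟩ := hN.exists_apex hT (hS hL₂) (hmem L₂ hL₂ hs₂)
  have p1 : N.PointsInto E L₁ := by
    rw [N.pointsInto_iff hne hz₁]
    exact side_of_mem_hull hε₁ hcn h1 (hz₁ ▸ hm₁)
  have p2 : ¬ N.PointsInto E L₂ := by
    rw [N.pointsInto_iff hne hz₂]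
    exact not_lt.2 (side_of_mem_hull_neg hε₂ hcn' h2 (hz₂ ▸ hm₂)).le
  have hL12 : L₁ ≠ L₂ := by rintro rfl; exact p2 p1
  have hset : T.filter (fun K => E ∈ edgesOf K) = {L₁, L₂} := by
    ext L
    simp only [Finset.mem_filter, Finset.mem_insert, Finset.mem_singleton]
    constructor
    · rintro ⟨hL, hEL⟩
      by_cases hp : N.PointsInto E L
      · left
        exact hT.eq_of_pointsInto_iff hN hL (hS hL₁) hEL (hmem L₁ hL₁ hs₁) (by simp [hp, p1])
      · right
        exact hT.eq_of_pointsInto_iff hN hL (hS hL₂) hEL (hmem L₂ hL₂ hs₂) (by simp [hp, p2])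
    · rintro (rfl | rfl)
      · exact ⟨hS hL₁, hmem _ hL₁ hs₁⟩
      · exact ⟨hS hL₂, hmem _ hL₂ hs₂⟩
  rw [signedSum, hset, Finset.sum_pair hL12, if_pos p1, if_neg p2, hg L₁ hL₁, hg L₂ hL₂]
  simp

lemma subsegment {a b a' b' : Pt} (hne : a' ≠ b') (h : hull {a', b'} ⊆ hull {a, b}) :
    midpoint ℝ a' b' ∈ openSegment ℝ a b ∧
      ∃ s τ : ℝ, τ ≠ 0 ∧ a' - a = s • (b - a) ∧ b' - a' = τ • (b - a) := by
  have h1 := h (mem_hull_of_mem (x := a') (by simp))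
  have h2 := h (mem_hull_of_mem (x := b') (by simp))
  rw [hull_pair] at h1 h2
  obtain ⟨s, t, hs, ht, hst, rfl⟩ := h1
  obtain ⟨s', t', hs', ht', hst', rfl⟩ := h2
  have e1 : s = 1 - t := by linarith
  have e2 : s' = 1 - t' := by linarith
  subst e1 e2
  have htt : t ≠ t' := by rintro rfl; exact hne rfl
  refine ⟨⟨((1 - t) + (1 - t')) / 2, (t + t') / 2, ?_, ?_, by ring, ?_⟩, t, t' - t,
    sub_ne_zero.2 htt.symm, by module, by module⟩
  · rcases lt_or_gt_of_ne htt with h | h <;> linarith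
  · rcases lt_or_gt_of_ne htt with h | h <;> linarith
  · rw [midpoint_eq_smul_add, invOf_eq_inv]; module

/-- On a part `E'` of an edge `E` of the coarse mesh, the jumps of a field that is given on the
triangles of the coarse mesh agree up to the sign `σ` relating the two edge numberings. -/
lemma Refines.signedSum_subedge (hR : Refines T T') (hT : IsTriangulation Ω T)
    (hT' : IsTriangulation Ω T') {N N' : EdgeNumbering} (hN : N.IsFor Ω T) (hN' : N'.IsFor Ω T')
    {P : Finset Pt → Finset Pt} (hP : ∀ K' ∈ T', P K' ∈ T ∧ hull K' ⊆ hull (P K'))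
    {E E' : Finset Pt} (hE : E ∈ edges T) (hE' : E' ∈ edges T') (hs : hull E' ⊆ hull E) :
    ∃ σ : ℝ, σ ^ 2 = 1 ∧ N'.tangent E' = σ • N.tangent E ∧ N'.normal E' = σ • N.normal E ∧
      ∀ g : Finset Pt → Pt, signedSum T' N' E' (fun K' => g (P K')) = σ • signedSum T N E g := by
  have hne := hN.fst_ne_snd hE
  have hEe := hN.ends E hE
  have hne' := hN'.fst_ne_snd hE'
  have hEe' := hN'.ends E' hE'
  set a := N.fst E with ha
  set b := N.snd E with hb
  set a' := N'.fst E' with ha'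
  set b' := N'.snd E' with hb'
  rw [hEe, hEe'] at hs
  obtain ⟨hmid, s, τ, hτ, h1, h2⟩ := subsegment hne' hs
  have hdist : dist a' b' = |τ| * dist a b := by
    rw [dist_comm, dist_eq_norm, h2, norm_smul, Real.norm_eq_abs, dist_comm a b, dist_eq_norm]
  have hd0 : dist a b ≠ 0 := (dist_pos.2 hne).ne'
  have htan : N'.tangent E' = (τ / |τ|) • N.tangent E := by
    rw [EdgeNumbering.tangent, EdgeNumbering.tangent, ← ha, ← hb, ← ha', ← hb', h2, hdist,
      smul_smul, smul_smul]
    congr 1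
    have : |τ| ≠ 0 := abs_ne_zero.2 hτ
    field_simp
  refine ⟨τ / |τ|, ?_, htan, ?_, fun g => ?_⟩
  · rw [div_pow, sq_abs, div_self (pow_ne_zero 2 hτ)]
  · rw [EdgeNumbering.normal, EdgeNumbering.normal, htan]
    apply pt_ext <;> simp
  have hcross : ∀ x, cross (b' - a') (x - a') = τ * cross (b - a) (x - a) := fun x => by
    have : x - a' = (x - a) + (-s) • (b - a) := by
      have : a' = a + s • (b - a) := by rw [← h1]; abel
      rw [this]; module
    rw [this, h2, cross_smul_left, cross_add_right, cross_smul_right, cross_self]; ring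
  have hmidE' : midpoint ℝ a' b' ∈ hull {a', b'} := by
    rw [hull_pair]; exact midpoint_mem_segment _ _
  obtain ⟨K₀, hK₀, hEK₀⟩ := mem_edges.1 hE
  obtain ⟨K₀', hK₀', hEK₀'⟩ := mem_edges.1 hE'
  have hEcard := (mem_edgesOf.1 hEK₀).2
  have hEcard' := (mem_edgesOf.1 hEK₀').2
  have hadj : ∀ K' ∈ T', E' ∈ edgesOf K' → E ∈ edgesOf (P K') := by
    intro K' hK' hEK'
    refine mem_edgesOf.2 ⟨?_, hEcard⟩
    rw [hEe]
    refine hT.pair_subset hK₀ (hP K' hK').1 (by rw [← hEe]; exact (mem_edgesOf.1 hEK₀).1) hne hmid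
      ((hP K' hK').2 (hull_mono (mem_edgesOf.1 hEK').1 ?_))
    rwa [hEe']
  have hsign : ∀ K' ∈ T', E' ∈ edgesOf K' →
      (N'.PointsInto E' K' ↔ if 0 < τ then N.PointsInto E (P K') else ¬ N.PointsInto E (P K')) := by
    intro K' hK' hEK'
    obtain ⟨z', hz', k1⟩ := hN'.exists_apex hT' hK' hEK'
    obtain ⟨z, hz, k2⟩ := hN.exists_apex hT (hP K' hK').1 (hadj K' hK' hEK')
    rw [N'.pointsInto_iff hne' hz', N.pointsInto_iff hne hz]
    simp only [← ha, ← hb, ← ha', ← hb'] at k1 k2 hz hz' ⊢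
    have hz'mem : z' ∈ hull {z, a, b} := by
      rw [← hz]; exact (hP K' hK').2 (mem_hull_of_mem (by rw [hz']; simp))
    have k3 := ((mem_hull_triple (by rwa [← cross_apex]) z').1 hz'mem).2.2
    rw [← cross_apex z a b] at k3
    rw [hcross] at k1 ⊢
    have k4 : cross (b - a) (z' - a) ≠ 0 := fun h => k1 (by rw [h, mul_zero])
    have k5 : 0 < cross (b - a) (z' - a) / cross (b - a) (z - a) :=
      lt_of_le_of_ne k3 (div_ne_zero k4 k2).symm
    split_ifs with hτ'
    · rw [mul_pos_iff_of_pos_left hτ']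
      rcases div_pos_iff.1 k5 with h | h
      · simp [h.1, h.2]
      · simp [not_lt.2 h.1.le, not_lt.2 h.2.le]
    · have hτn : τ < 0 := lt_of_le_of_ne (not_lt.1 hτ') hτ
      rw [mul_pos_iff, not_lt]
      rcases div_pos_iff.1 k5 with h | h
      · simp [hτ', not_lt.2 h.1.le, h.2]
      · simp [hτn, h.1, h.2.le]
  rw [signedSum, signedSum, Finset.smul_sum]
  refine Finset.sum_bij (fun K' _ => P K') ?_ ?_ ?_ ?_
  · intro K' hK'
    rw [Finset.mem_filter] at hK' ⊢
    exact ⟨(hP K' hK'.1).1, hadj K' hK'.1 hK'.2⟩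
  · intro K' hK' L' hL' hKL
    rw [Finset.mem_filter] at hK' hL'
    refine hT'.eq_of_pointsInto_iff hN' hK'.1 hL'.1 hK'.2 hL'.2 ?_
    rw [hsign K' hK'.1 hK'.2, hsign L' hL'.1 hL'.2]
    rw [hKL]
  · intro K hK
    rw [Finset.mem_filter] at hK
    obtain ⟨hK, hEK⟩ := hK
    obtain ⟨z, hz, -⟩ := hN.exists_apex hT hK hEK
    have hmK : midpoint ℝ a' b' ∈ hull K := hull_mono (mem_edgesOf.1 hEK).1 (by
      rw [hEe]; exact hs hmidE')
    have hzK : z ∈ hull K := mem_hull_of_mem (by rw [hz]; simp)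
    obtain ⟨K', hK', hsub, -⟩ := hT'.exists_adjacent (S := T'.filter fun K' => hull K' ⊆ hull K)
      (w := z - midpoint ℝ a' b') hK₀' (by rw [← hEe']; exact (mem_edgesOf.1 hEK₀').1) hne'
      (Finset.filter_subset _ _) (by
        refine Eventually.frequently ?_
        filter_upwards [Ioc_mem_nhdsGT (show (0 : ℝ) < 1 by norm_num)] with ε hε
        obtain ⟨L, hL, hLs, hLm⟩ := hR.cover K hK (midpoint ℝ a' b' + ε • (z - midpoint ℝ a' b'))
          ((convex_hull K).add_smul_sub_mem hmK hzK ⟨hε.1.le, hε.2⟩)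
        exact ⟨L, Finset.mem_filter.2 ⟨hL, hLs⟩, hLm⟩)
    rw [Finset.mem_filter] at hK'
    refine ⟨K', Finset.mem_filter.2 ⟨hK'.1, mem_edgesOf.2 ⟨by rw [hEe']; exact hsub, hEcard'⟩⟩, ?_⟩
    exact hT.eq_of_hull_subset (hP K' hK'.1).1 hK (hT'.isTriangle K' hK'.1) (hP K' hK'.1).2 hK'.2
  · intro K' hK'
    rw [Finset.mem_filter] at hK'
    have := hsign K' hK'.1 hK'.2
    rcases lt_or_gt_of_ne hτ with h | h
    · rw [if_neg (not_lt.2 h.le)] at this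
      have hσ : τ / |τ| = -1 := by rw [abs_of_neg h, div_neg, div_self hτ]
      rw [hσ]
      by_cases hp : N.PointsInto E (P K') <;> simp [this, hp]
    · rw [if_pos h] at this
      have hσ : τ / |τ| = 1 := by rw [abs_of_pos h, div_self hτ]
      rw [hσ]
      by_cases hp : N.PointsInto E (P K') <;> simp [this, hp]

/-! ### Polynomials -/

lemma polyEval_add (p q : MvPolynomial (Fin 2) ℝ) (x : Pt) :
    polyEval (p + q) x = polyEval p x + polyEval q x := by simp [polyEval]

lemma polyEval_sub (p q : MvPolynomial (Fin 2) ℝ) (x : Pt) :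
    polyEval (p - q) x = polyEval p x - polyEval q x := by simp [polyEval]

lemma polyEval_smul (c : ℝ) (p : MvPolynomial (Fin 2) ℝ) (x : Pt) :
    polyEval (c • p) x = c * polyEval p x := by simp [polyEval]

lemma continuous_polyEval (p : MvPolynomial (Fin 2) ℝ) : Continuous (polyEval p) := by
  unfold polyEval
  exact (MvPolynomial.continuous_eval p).comp (by fun_prop)

/-- The gradient of a polynomial. -/
def polyGrad (p : MvPolynomial (Fin 2) ℝ) (x : Pt) : Pt :=
  !₂[polyEval (MvPolynomial.pderiv 0 p) x, polyEval (MvPolynomial.pderiv 1 p) x]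

/-- The Laplacian of a polynomial. -/
def polyLap (p : MvPolynomial (Fin 2) ℝ) : MvPolynomial (Fin 2) ℝ :=
  MvPolynomial.pderiv 0 (MvPolynomial.pderiv 0 p) + MvPolynomial.pderiv 1 (MvPolynomial.pderiv 1 p)

lemma continuous_polyGrad (p : MvPolynomial (Fin 2) ℝ) : Continuous (polyGrad p) := by
  have h0 := continuous_polyEval (MvPolynomial.pderiv 0 p)
  have h1 := continuous_polyEval (MvPolynomial.pderiv 1 p)
  unfold polyGrad
  refine (PiLp.continuous_toLp 2 _).comp (continuous_pi fun i => ?_)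
  fin_cases i
  · exact h0
  · exact h1

lemma polyGrad_sub (p q : MvPolynomial (Fin 2) ℝ) (x : Pt) :
    polyGrad (p - q) x = polyGrad p x - polyGrad q x := by
  apply pt_ext <;> simp [polyGrad, polyEval_sub]

lemma polyLap_sub (p q : MvPolynomial (Fin 2) ℝ) : polyLap (p - q) = polyLap p - polyLap q := by
  simp only [polyLap, map_sub]; ring

lemma norm_sq_polyGrad (p : MvPolynomial (Fin 2) ℝ) (x : Pt) : ‖polyGrad p x‖ ^ 2 =
    polyEval (MvPolynomial.pderiv 0 p) x ^ 2 + polyEval (MvPolynomial.pderiv 1 p) x ^ 2 := by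
  rw [norm_sq_pt]; simp [polyGrad]

lemma hasFDerivAt_polyEval (p : MvPolynomial (Fin 2) ℝ) (x : Pt) :
    HasFDerivAt (polyEval p) (innerSL ℝ (polyGrad p x)) x := by
  induction p using MvPolynomial.induction_on with
  | C a =>
    have h : polyEval (MvPolynomial.C a) = fun _ => a := by ext; simp [polyEval]
    have h' : polyGrad (MvPolynomial.C a) x = 0 := by
      apply pt_ext <;> simp [polyGrad, polyEval]
    rw [h, h', map_zero]
    exact hasFDerivAt_const a x
  | add p q hp hq =>
    have h : polyEval (p + q) = fun y => polyEval p y + polyEval q y := by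
      ext y; exact polyEval_add p q y
    have h' : polyGrad (p + q) x = polyGrad p x + polyGrad q x := by
      apply pt_ext <;> simp [polyGrad, polyEval_add]
    rw [h, h', map_add]
    exact hp.add hq
  | mul_X p i hp =>
    have h : polyEval (p * MvPolynomial.X i) = fun y => polyEval p y * y i := by
      ext y; simp [polyEval]
    have hi : HasFDerivAt (fun y : Pt => y i) (EuclideanSpace.proj i : Pt →L[ℝ] ℝ) x :=
      (EuclideanSpace.proj i : Pt →L[ℝ] ℝ).hasFDerivAt
    rw [h]
    refine (hp.mul hi).congr_fderiv ?_
    ext y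
    fin_cases i <;> simp [inner_pt, polyGrad, polyEval, MvPolynomial.pderiv_X] <;> ring

lemma gradient_polyEval (p : MvPolynomial (Fin 2) ℝ) (x : Pt) :
    gradient (polyEval p) x = polyGrad p x := by
  apply HasGradientAt.gradient
  exact hasFDerivAt_polyEval p x

lemma contDiff_polyEval (p : MvPolynomial (Fin 2) ℝ) : ContDiff ℝ 2 (polyEval p) := by
  induction p using MvPolynomial.induction_on with
  | C a =>
    have h : polyEval (MvPolynomial.C a) = fun _ => a := by ext; simp [polyEval]
    rw [h]; exact contDiff_const
  | add p q hp hq =>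
    have h : polyEval (p + q) = fun y => polyEval p y + polyEval q y := by
      ext y; exact polyEval_add p q y
    rw [h]; exact hp.add hq
  | mul_X p i hp =>
    have h : polyEval (p * MvPolynomial.X i) = fun y => polyEval p y * y i := by
      ext y; simp [polyEval]
    rw [h]; exact hp.mul (by fun_prop)

lemma laplacian_polyEval (p : MvPolynomial (Fin 2) ℝ) (x : Pt) :
    Laplacian.laplacian (polyEval p) x = polyEval (polyLap p) x := by
  rw [InnerProductSpace.laplacian_eq_iteratedFDeriv_orthonormalBasis _
    (EuclideanSpace.basisFun (Fin 2) ℝ)]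
  have h1 : fderiv ℝ (polyEval p) = fun y => innerSL ℝ (polyGrad p y) := by
    ext1 y; exact (hasFDerivAt_polyEval p y).fderiv
  have hd : DifferentiableAt ℝ (fderiv ℝ (polyEval p)) x :=
    ((contDiff_polyEval p).fderiv_right (m := 1) (by norm_num)).differentiable (by norm_num) x
  have h2 : ∀ i : Fin 2, fderiv ℝ (fderiv ℝ (polyEval p)) x (EuclideanSpace.single i 1)
      (EuclideanSpace.single i 1) =
      polyEval (MvPolynomial.pderiv i (MvPolynomial.pderiv i p)) x := by
    intro i
    have e1 : (fun y => fderiv ℝ (polyEval p) y (EuclideanSpace.single i 1)) =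
        polyEval (MvPolynomial.pderiv i p) := by
      ext y
      rw [h1]
      fin_cases i <;> simp [inner_pt, polyGrad]
    have e2 := congrArg (fun F : Pt → ℝ => fderiv ℝ F x (EuclideanSpace.single i 1)) e1
    simp only [(hasFDerivAt_polyEval (MvPolynomial.pderiv i p) x).fderiv] at e2
    rw [fderiv_clm_apply hd (by fun_prop)] at e2
    simp only [fderiv_fun_const, Pi.zero_apply, ContinuousLinearMap.comp_zero, zero_add,
      ContinuousLinearMap.flip_apply] at e2
    rw [e2]
    fin_cases i <;> simp [inner_pt, polyGrad]
  simp only [iteratedFDeriv_two_apply, EuclideanSpace.basisFun_apply, Fin.sum_univ_two]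
  simp only [Matrix.cons_val_zero, Matrix.cons_val_one]
  rw [h2, h2, ← polyEval_add, polyLap]

lemma totalDegree_pderiv_le (p : MvPolynomial (Fin 2) ℝ) (i : Fin 2) :
    (MvPolynomial.pderiv i p).totalDegree ≤ p.totalDegree := by
  refine Finset.sup_le fun m hm => ?_
  rw [MvPolynomial.mem_support_iff, MvPolynomial.coeff_pderiv] at hm
  have h : m + Finsupp.single i 1 ∈ p.support := by
    rw [MvPolynomial.mem_support_iff]
    intro h
    exact hm (by rw [h, zero_mul])
  refine le_trans ?_ (MvPolynomial.le_totalDegree h)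
  rw [Finsupp.sum_add_index' (by simp) (by simp)]
  omega

/-- Composition of a polynomial with an affine map. -/
def affPoly (z p q : Pt) (g : MvPolynomial (Fin 2) ℝ) : MvPolynomial (Fin 2) ℝ :=
  MvPolynomial.bind₁ (fun i => MvPolynomial.C (z i) + MvPolynomial.C (p i) * MvPolynomial.X 0 +
    MvPolynomial.C (q i) * MvPolynomial.X 1) g

lemma polyEval_affPoly (z p q : Pt) (g : MvPolynomial (Fin 2) ℝ) (u : Pt) :
    polyEval (affPoly z p q g) u = polyEval g (affMap z p q u) := by
  rw [polyEval, polyEval, affPoly, MvPolynomial.eval, MvPolynomial.eval₂Hom_bind₁]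
  congr 1
  congr 1
  ext i
  simp [affMap, colMap_apply]
  ring

lemma totalDegree_affPoly_le (z p q : Pt) (g : MvPolynomial (Fin 2) ℝ) :
    (affPoly z p q g).totalDegree ≤ g.totalDegree := by
  set l : Fin 2 → MvPolynomial (Fin 2) ℝ := fun i => MvPolynomial.C (z i) +
    MvPolynomial.C (p i) * MvPolynomial.X 0 + MvPolynomial.C (q i) * MvPolynomial.X 1 with hl
  have hl1 : ∀ i, (l i).totalDegree ≤ 1 := fun i => by
    have hX : ∀ (c : ℝ) (j : Fin 2),
        (MvPolynomial.C c * MvPolynomial.X j : MvPolynomial (Fin 2) ℝ).totalDegree ≤ 1 :=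
      fun c j => (MvPolynomial.totalDegree_mul _ _).trans (by simp)
    refine (MvPolynomial.totalDegree_add _ _).trans (max_le ?_ (hX _ _))
    exact (MvPolynomial.totalDegree_add _ _).trans (max_le (by simp) (hX _ _))
  have h : affPoly z p q g = ∑ m ∈ g.support, MvPolynomial.bind₁ l
      (MvPolynomial.monomial m (g.coeff m)) := by
    conv_lhs => rw [affPoly, ← hl, g.as_sum, map_sum]
  rw [h]
  refine MvPolynomial.totalDegree_finsetSum_le fun m hm => ?_
  rw [MvPolynomial.bind₁_monomial]
  refine (MvPolynomial.totalDegree_mul _ _).trans ?_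
  rw [MvPolynomial.totalDegree_C, zero_add]
  refine (MvPolynomial.totalDegree_finsetProd _ _).trans
    (le_trans (Finset.sum_le_sum fun i _ => ?_) (MvPolynomial.le_totalDegree hm))
  exact (MvPolynomial.totalDegree_pow _ _).trans (by nlinarith [hl1 i])

lemma pderiv_affPoly (z p q : Pt) (g : MvPolynomial (Fin 2) ℝ) (u : Pt) :
    polyEval (MvPolynomial.pderiv 0 (affPoly z p q g)) u =
        ⟪polyGrad g (affMap z p q u), p⟫ ∧
      polyEval (MvPolynomial.pderiv 1 (affPoly z p q g)) u =
        ⟪polyGrad g (affMap z p q u), q⟫ := by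
  have h1 := hasFDerivAt_polyEval (affPoly z p q g) u
  have h2 := (hasFDerivAt_polyEval g (affMap z p q u)).comp u (hasFDerivAt_affMap z p q u)
  have h3 : polyEval g ∘ affMap z p q = polyEval (affPoly z p q g) := by
    ext v; rw [polyEval_affPoly]; rfl
  rw [h3] at h2
  have h4 := h1.unique h2
  have e0 := congrArg (fun f : Pt →L[ℝ] ℝ => f (EuclideanSpace.single 0 1)) h4
  have e1 := congrArg (fun f : Pt →L[ℝ] ℝ => f (EuclideanSpace.single 1 1)) h4
  simp only [ContinuousLinearMap.comp_apply, colMap_apply, innerSL_apply_apply] at e0 e1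
  constructor
  · rw [inner_pt] at e0; simpa [polyGrad] using e0
  · rw [inner_pt] at e1; simpa [polyGrad] using e1

/-! ### Inverse estimates -/

lemma exists_sq_le_inner {V : Type*} [AddCommGroup V] [Module ℝ V] [FiniteDimensional ℝ V]
    (core : InnerProductSpace.Core ℝ V) (l : V →ₗ[ℝ] ℝ) :
    ∃ C : ℝ, 0 ≤ C ∧ ∀ v, l v ^ 2 ≤ C * core.inner v v := by
  let _ := core.toNormedAddCommGroup
  let _ : InnerProductSpace ℝ V := InnerProductSpace.ofCore core.toCore
  refine ⟨‖l.toContinuousLinearMap‖ ^ 2, by positivity, fun v => ?_⟩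
  have h := l.toContinuousLinearMap.le_opNorm v
  have h2 : core.inner v v = ‖v‖ ^ 2 := real_inner_self_eq_norm_sq v
  rw [h2, ← mul_pow, ← sq_abs]
  exact pow_le_pow_left₀ (abs_nonneg _) h 2

lemma integrableOn_refTri {g : Pt → ℝ} (hg : Continuous g) : IntegrableOn g refTri :=
  hg.continuousOn.integrableOn_compact isCompact_refTri

lemma eq_zero_of_integral_sq_eq_zero {p : MvPolynomial (Fin 2) ℝ}
    (h : ∫ u in refTri, polyEval p u * polyEval p u = 0) : p = 0 := by
  have hc := continuous_polyEval p
  rw [setIntegral_eq_zero_iff_of_nonneg_ae (Eventually.of_forall fun u => mul_self_nonneg _)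
    (integrableOn_refTri (hc.mul hc))] at h
  have h1 := ae_restrict_of_ae_restrict_of_subset refTri_nhds h
  have h2 := Measure.eqOn_open_of_ae_eq h1 isOpen_refTri_interior (hc.mul hc).continuousOn
    continuousOn_const
  refine MvPolynomial.funext_set (fun _ => Ioo (0 : ℝ) (1 / 2))
    (fun _ => Ioo_infinite (by norm_num)) fun x hx => ?_
  have hx0 := hx 0 (mem_univ _)
  have hx1 := hx 1 (mem_univ _)
  have h3 := h2 (show !₂[x 0, x 1] ∈ {u : Pt | 0 < u 0 ∧ 0 < u 1 ∧ u 0 + u 1 < 1} from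
    ⟨hx0.1, hx1.1, by simp; linarith [hx0.2, hx1.2]⟩)
  have h4 : polyEval p !₂[x 0, x 1] = 0 := mul_self_eq_zero.1 h3
  rw [polyEval] at h4
  rw [map_zero, ← h4]
  congr 1
  congr 1
  ext i
  fin_cases i <;> rfl

/-- The `L²` inner product on the polynomials of degree at most `k` on the reference triangle. -/
@[reducible] def polyCore (k : ℕ) :
    InnerProductSpace.Core ℝ (MvPolynomial.restrictTotalDegree (Fin 2) ℝ k) where
  inner p q := ∫ u in refTri, polyEval (p : MvPolynomial (Fin 2) ℝ) u * polyEval q u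
  conj_inner_symm p q := by simp [mul_comm]
  re_inner_nonneg p := integral_nonneg fun u => mul_self_nonneg _
  add_left p q r := by
    have hp := continuous_polyEval (p : MvPolynomial (Fin 2) ℝ)
    have hq := continuous_polyEval (q : MvPolynomial (Fin 2) ℝ)
    have hr := continuous_polyEval (r : MvPolynomial (Fin 2) ℝ)
    refine Eq.trans ?_ (integral_add (integrableOn_refTri (hp.mul hr))
      (integrableOn_refTri (hq.mul hr)))
    simp [polyEval_add, add_mul]
  smul_left p q c := by
    rw [← integral_const_mul]
    simp [polyEval_smul, mul_assoc]
  definite p hp := Subtype.ext (eq_zero_of_integral_sq_eq_zero hp)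

lemma exists_refTri_bound (k : ℕ)
    (D : MvPolynomial (Fin 2) ℝ →ₗ[ℝ] MvPolynomial (Fin 2) ℝ) :
    ∃ C : ℝ, 0 ≤ C ∧ ∀ p : MvPolynomial (Fin 2) ℝ, p.totalDegree ≤ k → ∀ u ∈ refTri,
      polyEval (D p) u ^ 2 ≤ C * ∫ w in refTri, polyEval p w ^ 2 := by
  let b := Module.finBasis ℝ (MvPolynomial.restrictTotalDegree (Fin 2) ℝ k)
  choose C hC0 hC using fun j => exists_sq_le_inner (polyCore k) (b.coord j)
  have hM : ∀ j, ∃ M : ℝ, 0 ≤ M ∧ ∀ u ∈ refTri,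
      polyEval (D (b j : MvPolynomial (Fin 2) ℝ)) u ^ 2 ≤ M := fun j => by
    obtain ⟨M, hM⟩ := isCompact_refTri.exists_bound_of_continuousOn
      (continuous_polyEval (D (b j : MvPolynomial (Fin 2) ℝ))).continuousOn
    refine ⟨M ^ 2, sq_nonneg _, fun u hu => ?_⟩
    rw [← sq_abs]
    exact pow_le_pow_left₀ (abs_nonneg _) (hM u hu) 2
  choose M hM0 hM using hM
  refine ⟨∑ j, Fintype.card (Fin (Module.finrank ℝ
    (MvPolynomial.restrictTotalDegree (Fin 2) ℝ k))) * (C j * M j), ?_, fun p hp u hu => ?_⟩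
  · exact Finset.sum_nonneg fun j _ => by have := hC0 j; have := hM0 j; positivity
  set P : MvPolynomial.restrictTotalDegree (Fin 2) ℝ k :=
    ⟨p, (MvPolynomial.mem_restrictTotalDegree _ _ _).2 hp⟩ with hP
  have hQ : (polyCore k).inner P P = ∫ w in refTri, polyEval p w ^ 2 := by
    simp only [sq]; rfl
  have hsum : polyEval (D p) u =
      ∑ j, b.coord j P * polyEval (D (b j : MvPolynomial (Fin 2) ℝ)) u := by
    have h1 : p = ∑ j, b.coord j P • (b j : MvPolynomial (Fin 2) ℝ) := by
      calc p = ((∑ j, b.repr P j • b j :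
            MvPolynomial.restrictTotalDegree (Fin 2) ℝ k) : MvPolynomial (Fin 2) ℝ) := by
            rw [b.sum_repr]
        _ = _ := by rw [AddSubmonoidClass.coe_finsetSum]; rfl
    conv_lhs => rw [h1]
    simp [polyEval]
  rw [hsum, ← hQ, Finset.sum_mul]
  refine (sq_sum_le_card_mul_sum_sq).trans ?_
  rw [Finset.mul_sum]
  refine Finset.sum_le_sum fun j _ => ?_
  rw [mul_pow, Finset.card_univ, mul_assoc]
  refine mul_le_mul_of_nonneg_left ?_ (by positivity)
  calc b.coord j P ^ 2 * polyEval (D (b j : MvPolynomial (Fin 2) ℝ)) u ^ 2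
      ≤ (C j * (polyCore k).inner P P) * M j :=
        mul_le_mul (hC j P) (hM j u hu) (sq_nonneg _) ((sq_nonneg _).trans (hC j P))
    _ = C j * M j * (polyCore k).inner P P := by ring

/-! ### Estimates on triangles -/

lemma integrableOn_hull {g : Pt → ℝ} (hg : Continuous g) (K : Finset Pt) :
    IntegrableOn g (hull K) :=
  hg.continuousOn.integrableOn_compact (isCompact_hull K)

lemma setIntegral_hull_le {g : Pt → ℝ} (hg : Continuous g) {K : Finset Pt} {M : ℝ}
    (hM : ∀ x ∈ hull K, g x ≤ M) : ∫ x in hull K, g x ≤ area K * M := by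
  calc ∫ x in hull K, g x ≤ ∫ _ in hull K, M :=
        setIntegral_mono_on (integrableOn_hull hg K) (integrableOn_hull continuous_const K)
          (isClosed_hull K).measurableSet hM
    _ = area K * M := by simp [area]

lemma exists_polyEval_sq_le (k : ℕ) : ∃ C : ℝ, 0 ≤ C ∧ ∀ K : Finset Pt, IsTriangle K →
    ∀ g : MvPolynomial (Fin 2) ℝ, g.totalDegree ≤ k → ∀ x ∈ hull K,
      area K * polyEval g x ^ 2 ≤ C * ∫ y in hull K, polyEval g y ^ 2 := by
  obtain ⟨C, hC0, hC⟩ := exists_refTri_bound k LinearMap.id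
  refine ⟨C * refArea, mul_nonneg hC0 refArea_pos.le, fun K hK g hg x hx => ?_⟩
  obtain ⟨z, a, b, rfl, h⟩ := hK.exists_rep
  rw [area_triple h, setIntegral_hull h]
  rw [hull_eq_image] at hx
  obtain ⟨u, hu, rfl⟩ := hx
  have h1 := hC (affPoly z (a - z) (b - z) g) ((totalDegree_affPoly_le _ _ _ _).trans hg) u hu
  simp only [LinearMap.id_coe, id_eq, polyEval_affPoly] at h1
  have := refArea_pos
  calc |cross (a - z) (b - z)| * refArea * polyEval g (affMap z (a - z) (b - z) u) ^ 2
      ≤ |cross (a - z) (b - z)| * refArea *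
        (C * ∫ w in refTri, polyEval g (affMap z (a - z) (b - z) w) ^ 2) :=
        mul_le_mul_of_nonneg_left h1 (by positivity)
    _ = _ := by ring

lemma exists_pderiv_sq_le (k : ℕ) : ∃ C : ℝ, 0 ≤ C ∧ ∀ (σ : ℝ) (K : Finset Pt), IsTriangle K →
    ShapeBound σ K → ∀ g : MvPolynomial (Fin 2) ℝ, g.totalDegree ≤ k → ∀ i : Fin 2,
      area K * ∫ y in hull K, polyEval (MvPolynomial.pderiv i g) y ^ 2 ≤
        C * σ * ∫ y in hull K, polyEval g y ^ 2 := by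
  obtain ⟨C₀, hC₀0, hC₀⟩ := exists_refTri_bound k (MvPolynomial.pderiv 0).toLinearMap
  obtain ⟨C₁, hC₁0, hC₁⟩ := exists_refTri_bound k (MvPolynomial.pderiv 1).toLinearMap
  have hc := refArea_pos
  refine ⟨2 * refArea ^ 3 * (C₀ + C₁), by positivity, fun σ K hK hσ g hg i => ?_⟩
  have hA := hK.area_pos
  suffices hpt : ∀ x ∈ hull K, polyEval (MvPolynomial.pderiv i g) x ^ 2 ≤
      (2 * refArea ^ 3 * (C₀ + C₁) * σ * ∫ y in hull K, polyEval g y ^ 2) / area K ^ 2 by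
    have h1 := setIntegral_hull_le ((continuous_polyEval (MvPolynomial.pderiv i g)).pow 2) hpt
    calc area K * ∫ y in hull K, polyEval (MvPolynomial.pderiv i g) y ^ 2
        ≤ area K * (area K * ((2 * refArea ^ 3 * (C₀ + C₁) * σ *
          ∫ y in hull K, polyEval g y ^ 2) / area K ^ 2)) := mul_le_mul_of_nonneg_left h1 hA.le
      _ = _ := by field_simp
  intro x hx
  obtain ⟨z, a, b, rfl, h⟩ := hK.exists_rep
  have hp : ‖a - z‖ ^ 2 ≤ σ * area {z, a, b} := by
    rw [← dist_eq_norm]; exact hσ a (by simp) z (by simp)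
  have hq : ‖b - z‖ ^ 2 ≤ σ * area {z, a, b} := by
    rw [← dist_eq_norm]; exact hσ b (by simp) z (by simp)
  rw [le_div_iff₀ (by positivity)]
  rw [hull_eq_image] at hx
  obtain ⟨u, hu, rfl⟩ := hx
  have hdeg := (totalDegree_affPoly_le z (a - z) (b - z) g).trans hg
  have h0 := hC₀ _ hdeg u hu
  have h1 := hC₁ _ hdeg u hu
  simp only [Derivation.coeFn_coe, (pderiv_affPoly z (a - z) (b - z) g u).1,
    (pderiv_affPoly z (a - z) (b - z) g u).2, polyEval_affPoly] at h0 h1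
  have hI := setIntegral_hull h (fun y => polyEval g y ^ 2)
  set I := ∫ w in refTri, polyEval g (affMap z (a - z) (b - z) w) ^ 2 with hIdef
  have hI0 : 0 ≤ I := integral_nonneg fun _ => sq_nonneg _
  set G := polyGrad g (affMap z (a - z) (b - z) u) with hG
  set s := ⟪G, a - z⟫ with hs
  set t := ⟪G, b - z⟫ with ht
  have hGi : polyEval (MvPolynomial.pderiv i g) (affMap z (a - z) (b - z) u) = G i := by
    fin_cases i <;> simp [hG, polyGrad]
  have hsolve : (cross (a - z) (b - z) * G i) ^ 2 ≤
      2 * (‖b - z‖ ^ 2 * s ^ 2 + ‖a - z‖ ^ 2 * t ^ 2) := by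
    rw [norm_sq_pt, norm_sq_pt, hs, ht, inner_pt, inner_pt]
    generalize a - z = p
    generalize b - z = q
    generalize G = G
    have key : ∀ A B S T e f : ℝ, (A * S - B * T) ^ 2 ≤
        2 * ((A ^ 2 + e ^ 2) * S ^ 2 + (B ^ 2 + f ^ 2) * T ^ 2) := fun A B S T e f => by
      nlinarith [sq_nonneg (A * S + B * T), sq_nonneg (e * S), sq_nonneg (f * T)]
    fin_cases i
    · refine le_trans (le_of_eq ?_) ((key (q 1) (p 1) (G 0 * p 0 + G 1 * p 1)
        (G 0 * q 0 + G 1 * q 1) (q 0) (p 0)).trans (le_of_eq (by ring)))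
      simp only [cross]; ring_nf; simp
    · refine le_trans (le_of_eq ?_) (key (q 0) (p 0) (G 0 * p 0 + G 1 * p 1)
        (G 0 * q 0 + G 1 * q 1) (q 1) (p 1))
      simp only [cross]; ring_nf; simp
  rw [hGi, hI]
  have hb : (cross (a - z) (b - z) * G i) ^ 2 ≤ 2 * (σ * area {z, a, b}) * ((C₀ + C₁) * I) := by
    have hσA : 0 ≤ σ * area {z, a, b} := (sq_nonneg _).trans hp
    calc (cross (a - z) (b - z) * G i) ^ 2
        ≤ 2 * (‖b - z‖ ^ 2 * s ^ 2 + ‖a - z‖ ^ 2 * t ^ 2) := hsolve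
      _ ≤ 2 * (σ * area {z, a, b} * (C₀ * I) + σ * area {z, a, b} * (C₁ * I)) := by gcongr
      _ = _ := by ring
  rw [area_triple h] at hb ⊢
  calc G i ^ 2 * (|cross (a - z) (b - z)| * refArea) ^ 2
      = refArea ^ 2 * (cross (a - z) (b - z) * G i) ^ 2 := by rw [mul_pow, sq_abs]; ring
    _ ≤ refArea ^ 2 * (2 * (σ * (|cross (a - z) (b - z)| * refArea)) * ((C₀ + C₁) * I)) :=
        mul_le_mul_of_nonneg_left hb (by positivity)
    _ = _ := by ring

lemma integral_norm_sq_polyGrad (p : MvPolynomial (Fin 2) ℝ) (K : Finset Pt) :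
    ∫ y in hull K, ‖polyGrad p y‖ ^ 2 =
      (∫ y in hull K, polyEval (MvPolynomial.pderiv 0 p) y ^ 2) +
        ∫ y in hull K, polyEval (MvPolynomial.pderiv 1 p) y ^ 2 := by
  have hi : ∀ g : MvPolynomial (Fin 2) ℝ, IntegrableOn (fun y => polyEval g y ^ 2) (hull K) :=
    fun g => integrableOn_hull ((continuous_polyEval g).pow 2) K
  rw [← integral_add (hi _) (hi _)]
  simp only [norm_sq_polyGrad]

lemma exists_polyLap_le (k : ℕ) : ∃ C : ℝ, 0 ≤ C ∧ ∀ (σ : ℝ) (K : Finset Pt), IsTriangle K →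
    ShapeBound σ K → ∀ p : MvPolynomial (Fin 2) ℝ, p.totalDegree ≤ k →
      area K * ∫ y in hull K, polyEval (polyLap p) y ^ 2 ≤
        C * σ * ∫ y in hull K, ‖polyGrad p y‖ ^ 2 := by
  obtain ⟨C, hC0, hC⟩ := exists_pderiv_sq_le k
  refine ⟨2 * C, by positivity, fun σ K hK hσ p hp => ?_⟩
  have h0 := hC σ K hK hσ _ ((totalDegree_pderiv_le p 0).trans hp) 0
  have h1 := hC σ K hK hσ _ ((totalDegree_pderiv_le p 1).trans hp) 1
  have hi : ∀ g : MvPolynomial (Fin 2) ℝ, IntegrableOn (fun y => polyEval g y ^ 2) (hull K) :=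
    fun g => integrableOn_hull ((continuous_polyEval g).pow 2) K
  have e2 : ∫ y in hull K, polyEval (polyLap p) y ^ 2 ≤
      2 * (∫ y in hull K, polyEval (MvPolynomial.pderiv 0 (MvPolynomial.pderiv 0 p)) y ^ 2) +
        2 * ∫ y in hull K, polyEval (MvPolynomial.pderiv 1 (MvPolynomial.pderiv 1 p)) y ^ 2 := by
    rw [← integral_const_mul, ← integral_const_mul,
      ← integral_add ((hi _).const_mul 2) ((hi _).const_mul 2)]
    refine integral_mono (hi _) (((hi _).const_mul 2).add ((hi _).const_mul 2)) fun y => ?_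
    simp only [polyLap, polyEval_add]
    nlinarith [sq_nonneg (polyEval (MvPolynomial.pderiv 0 (MvPolynomial.pderiv 0 p)) y -
      polyEval (MvPolynomial.pderiv 1 (MvPolynomial.pderiv 1 p)) y)]
  rw [integral_norm_sq_polyGrad]
  have := mul_le_mul_of_nonneg_left e2 hK.area_pos.le
  linarith

/-! ### Integrals over edges -/

lemma hausdorffMeasure_hull_pair (a b : Pt) :
    Measure.hausdorffMeasure 1 (hull {a, b}) = edist a b := by
  rw [hull_pair, hausdorffMeasure_segment]

lemma hausdorffMeasure_edge_lt_top {K E : Finset Pt} (hE : E ∈ edgesOf K) :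
    Measure.hausdorffMeasure 1 (hull E) < ⊤ := by
  obtain ⟨a, b, -, rfl⟩ := exists_pair_of_mem_edgesOf hE
  rw [hausdorffMeasure_hull_pair]; exact edist_lt_top _ _

lemma integrableOn_edge {K E : Finset Pt} (hE : E ∈ edgesOf K) {g : Pt → ℝ} (hg : Continuous g) :
    IntegrableOn g (hull E) (Measure.hausdorffMeasure 1) := by
  obtain ⟨M, hM⟩ := (isCompact_hull E).exists_bound_of_continuousOn hg.continuousOn
  refine Measure.integrableOn_of_bounded (M := M) (hausdorffMeasure_edge_lt_top hE).ne
    hg.aestronglyMeasurable ?_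
  exact (ae_restrict_iff' (isClosed_hull E).measurableSet).2 (Eventually.of_forall hM)

lemma edgeIntegral_congr {E : Finset Pt} {g h : Pt → ℝ} (H : ∀ x ∈ hull E, g x = h x) :
    edgeIntegral E g = edgeIntegral E h :=
  setIntegral_congr_fun (isClosed_hull E).measurableSet H

lemma edgeIntegral_nonneg {E : Finset Pt} {g : Pt → ℝ} (H : ∀ x, 0 ≤ g x) :
    0 ≤ edgeIntegral E g := integral_nonneg H

lemma edgeIntegral_mono {K E : Finset Pt} (hE : E ∈ edgesOf K) {g h : Pt → ℝ} (hg : Continuous g)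
    (hh : Continuous h) (H : ∀ x ∈ hull E, g x ≤ h x) : edgeIntegral E g ≤ edgeIntegral E h :=
  setIntegral_mono_on (integrableOn_edge hE hg) (integrableOn_edge hE hh)
    (isClosed_hull E).measurableSet H

lemma edgeIntegral_add {K E : Finset Pt} (hE : E ∈ edgesOf K) {g h : Pt → ℝ} (hg : Continuous g)
    (hh : Continuous h) :
    edgeIntegral E (fun x => g x + h x) = edgeIntegral E g + edgeIntegral E h :=
  integral_add (integrableOn_edge hE hg) (integrableOn_edge hE hh)

lemma edgeIntegral_const_mul (E : Finset Pt) (c : ℝ) (g : Pt → ℝ) :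
    edgeIntegral E (fun x => c * g x) = c * edgeIntegral E g :=
  integral_const_mul _ _

lemma edgeIntegral_sum {K E : Finset Pt} (hE : E ∈ edgesOf K) {ι : Type*} (s : Finset ι)
    {g : ι → Pt → ℝ} (hg : ∀ i, Continuous (g i)) :
    edgeIntegral E (fun x => ∑ i ∈ s, g i x) = ∑ i ∈ s, edgeIntegral E (g i) :=
  integral_finsetSum _ fun i _ => integrableOn_edge hE (hg i)

lemma edgeIntegral_le {K : Finset Pt} {a b : Pt} (hE : {a, b} ∈ edgesOf K) {g : Pt → ℝ}
    (hg : Continuous g) {M : ℝ} (hM : ∀ x ∈ hull {a, b}, g x ≤ M) :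
    edgeIntegral {a, b} g ≤ dist a b * M := by
  refine (edgeIntegral_mono hE hg continuous_const hM).trans (le_of_eq ?_)
  rw [edgeIntegral, setIntegral_const, Measure.real, hausdorffMeasure_hull_pair, edist_dist,
    ENNReal.toReal_ofReal dist_nonneg, smul_eq_mul]

/-- Integrals over nonoverlapping edges contained in an edge sum up to at most the integral over
the latter. -/
lemma sum_edgeIntegral_le (hT' : IsTriangulation Ω T') {K E : Finset Pt} (hE : E ∈ edgesOf K)
    {F : Finset (Finset Pt)} (hF : F ⊆ edges T') (hsub : ∀ E' ∈ F, hull E' ⊆ hull E) {h : Pt → ℝ}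
    (hc : Continuous h) (h0 : ∀ x, 0 ≤ h x) :
    ∑ E' ∈ F, edgeIntegral E' h ≤ edgeIntegral E h := by
  have hint := integrableOn_edge hE hc
  have hnull : ∀ E' ∈ edges T', ∀ E'' ∈ edges T', E' ≠ E'' →
      Measure.hausdorffMeasure 1 (hull E' ∩ hull E'') = 0 := by
    intro E' hE' E'' hE'' hne
    obtain ⟨K', hK', hEK'⟩ := mem_edges.1 hE'
    obtain ⟨K'', hK'', hEK''⟩ := mem_edges.1 hE''
    refine measure_mono_null (hT'.hull_inter_edges hK' hK'' hEK' hEK'') ?_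
    have hc' := (mem_edgesOf.1 hEK').2
    have hc'' := (mem_edgesOf.1 hEK'').2
    have hcard : (E' ∩ E'').card ≤ 1 := by
      by_contra hlt
      have h2 : E'.card ≤ (E' ∩ E'').card := by omega
      have h3 := Finset.eq_of_subset_of_card_le Finset.inter_subset_left h2
      have h4 := Finset.eq_of_subset_of_card_le (h3 ▸ Finset.inter_subset_right : E' ⊆ E'')
        (by omega)
      exact hne h4
    obtain ⟨x, hx⟩ := Finset.card_le_one_iff_subset_singleton.1 hcard
    refine measure_mono_null (hull_mono hx) ?_
    have := hausdorffMeasure_hull_pair x x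
    simpa using this
  have key : ∀ F : Finset (Finset Pt), F ⊆ edges T' → (∀ E' ∈ F, hull E' ⊆ hull E) →
      ∑ E' ∈ F, edgeIntegral E' h =
        ∫ x in ⋃ E' ∈ F, hull E', h x ∂(Measure.hausdorffMeasure 1) := by
    intro F
    induction F using Finset.induction_on with
    | empty => intro _ _; simp
    | insert E₀ F hE₀ ih =>
      intro hF hsub
      have hF' : F ⊆ edges T' := fun x hx => hF (Finset.mem_insert_of_mem hx)
      have hsub' : ∀ E' ∈ F, hull E' ⊆ hull E := fun x hx => hsub x (Finset.mem_insert_of_mem hx)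
      rw [Finset.sum_insert hE₀, ih hF' hsub', Finset.set_biUnion_insert, setIntegral_union₀]
      · rfl
      · rw [AEDisjoint, inter_iUnion₂]
        refine (measure_biUnion_null_iff F.countable_toSet).2 fun E' hE' => ?_
        exact hnull _ (hF (Finset.mem_insert_self _ _)) _ (hF' hE')
          (fun h => hE₀ (h ▸ hE'))
      · exact (Finset.measurableSet_biUnion _ fun E' _ =>
          (isClosed_hull E').measurableSet).nullMeasurableSet
      · exact hint.mono_set (hsub _ (Finset.mem_insert_self _ _))
      · exact hint.mono_set (iUnion₂_subset hsub')
  rw [key F hF hsub]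
  exact setIntegral_mono_set hint (Eventually.of_forall h0)
    (iUnion₂_subset hsub).eventuallyLE

/-- A discrete trace inequality: the edge integral, weighted with the size of any of the triangles
at the edge. -/
lemma exists_trace_le (k : ℕ) (σ : ℝ) : ∃ C : ℝ, 0 ≤ C ∧ ∀ K L E : Finset Pt, IsTriangle K →
    IsTriangle L → E ∈ edgesOf K → E ∈ edgesOf L → ShapeBound σ K → ShapeBound σ L →
    ∀ p : MvPolynomial (Fin 2) ℝ, p.totalDegree ≤ k →
      √(area K) * edgeIntegral E (fun x => ‖polyGrad p x‖ ^ 2) ≤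
        C * ∫ x in hull L, ‖polyGrad p x‖ ^ 2 := by
  obtain ⟨C, hC0, hC⟩ := exists_polyEval_sq_le k
  have hc := refArea_pos
  refine ⟨refArea * √σ * |σ| * C, by positivity, fun K L E hK hL hEK hEL hσK hσL p hp => ?_⟩
  obtain ⟨a, b, hab, rfl⟩ := exists_pair_of_mem_edgesOf hEK
  have hAK := hK.area_pos
  have hAL := hL.area_pos
  set I := ∫ x in hull L, ‖polyGrad p x‖ ^ 2 with hI
  have hI0 : 0 ≤ I := integral_nonneg fun _ => sq_nonneg _
  have hsup : ∀ x ∈ hull L, ‖polyGrad p x‖ ^ 2 ≤ C * I / area L := by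
    intro x hx
    rw [le_div_iff₀ hAL, norm_sq_polyGrad]
    have h0 := hC L hL _ ((totalDegree_pderiv_le p 0).trans hp) x hx
    have h1 := hC L hL _ ((totalDegree_pderiv_le p 1).trans hp) x hx
    rw [hI, integral_norm_sq_polyGrad]
    linarith
  have hint : edgeIntegral {a, b} (fun x => ‖polyGrad p x‖ ^ 2) ≤ dist a b * (C * I / area L) :=
    edgeIntegral_le hEK ((continuous_polyGrad p).norm.pow 2) fun x hx =>
      hsup x (hull_mono (mem_edgesOf.1 hEL).1 hx)
  have hdL : dist a b ^ 2 ≤ |σ| * area L :=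
    (hσL a ((mem_edgesOf.1 hEL).1 (by simp)) b ((mem_edgesOf.1 hEL).1 (by simp))).trans
      (mul_le_mul_of_nonneg_right (le_abs_self σ) hAL.le)
  have hdK : √(area K) ≤ refArea * √σ * dist a b := by
    obtain ⟨z, hz, -, h⟩ := hK.exists_apex hEK rfl
    have h1 : area K ≤ refArea * (dist a b * √(σ * area K)) := by
      conv_lhs => rw [hz, area_triple h, ← cross_apex, mul_comm]
      refine mul_le_mul_of_nonneg_left ((abs_cross_le _ _).trans ?_) hc.le
      rw [← dist_eq_norm, ← dist_eq_norm, dist_comm b a]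
      refine mul_le_mul_of_nonneg_left (Real.le_sqrt_of_sq_le ?_) dist_nonneg
      exact hσK z (by rw [hz]; simp) a (by rw [hz]; simp)
    rw [Real.sqrt_mul' σ hAK.le] at h1
    have hs := Real.sqrt_pos.2 hAK
    have h2 : √(area K) * √(area K) ≤ (refArea * √σ * dist a b) * √(area K) := by
      rw [Real.mul_self_sqrt hAK.le]; linarith
    exact le_of_mul_le_mul_right h2 hs
  calc √(area K) * edgeIntegral {a, b} (fun x => ‖polyGrad p x‖ ^ 2)
      ≤ (refArea * √σ * dist a b) * (dist a b * (C * I / area L)) :=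
        mul_le_mul hdK hint (edgeIntegral_nonneg fun _ => sq_nonneg _) (by positivity)
    _ = refArea * √σ * (C * I / area L) * dist a b ^ 2 := by ring
    _ ≤ refArea * √σ * (C * I / area L) * (|σ| * area L) :=
        mul_le_mul_of_nonneg_left hdL (by positivity)
    _ = _ := by field_simp

/-! ### The domain and the mesh -/

lemma IsPolygonalLipschitzDomain.closure_ae_eq (hΩ : IsPolygonalLipschitzDomain Ω) :
    closure Ω =ᵐ[volume] Ω := by
  refine EventuallyLE.antisymm ?_ subset_closure.eventuallyLE
  rw [ae_le_set]
  have h1 : closure Ω \ Ω = frontier Ω := by rw [frontier, hΩ.isOpen.interior_eq]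
  obtain ⟨S, hS⟩ := hΩ.polygonal
  rw [h1, hS]
  refine (measure_biUnion_null_iff S.countable_toSet).2 fun s _ => ?_
  have hsub : segment ℝ s.1 s.2 ⊆ (affineSpan ℝ ({s.1, s.2} : Set Pt) : Set Pt) := by
    rw [← convexHull_pair]; exact convexHull_subset_affineSpan _
  refine measure_mono_null hsub (Measure.addHaar_affineSubspace volume _ fun htop => ?_)
  have h3 : Module.finrank ℝ (vectorSpan ℝ ({s.1, s.2} : Set Pt)) ≤ 1 :=
    collinear_iff_finrank_le_one.1 (collinear_pair ℝ s.1 s.2)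
  rw [← direction_affineSpan, htop, AffineSubspace.direction_top, finrank_top] at h3
  simp at h3

lemma IsTriangulation.iUnion_interior_ae_eq (hT : IsTriangulation Ω T)
    (hΩ : IsPolygonalLipschitzDomain Ω) : ⋃ K ∈ T, interior (hull K) =ᵐ[volume] Ω := by
  refine EventuallyEq.trans ?_ hΩ.closure_ae_eq
  rw [← hT.cover]
  exact Filter.EventuallyEq.countable_bUnion T.countable_toSet fun K _ => interior_hull_ae_eq K

lemma setIntegral_interior (K : Finset Pt) (g : Pt → ℝ) :
    ∫ x in interior (hull K), g x = ∫ x in hull K, g x :=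
  setIntegral_congr_set (interior_hull_ae_eq K)

lemma IsTriangulation.integrableOn_residual (hT : IsTriangulation Ω T)
    (hΩ : IsPolygonalLipschitzDomain Ω) {f : Pt → ℝ} (hf : MemLp f 2 (volume.restrict Ω))
    {K : Finset Pt} (hK : K ∈ T) (g : MvPolynomial (Fin 2) ℝ) :
    IntegrableOn (fun x => (f x + polyEval g x) ^ 2) (interior (hull K)) := by
  have h1 : MemLp f 2 (volume.restrict (interior (hull K))) := by
    rw [← Measure.restrict_congr_set (hT.iUnion_interior_ae_eq hΩ)] at hf
    exact hf.mono_measure (Measure.restrict_mono_set _ (subset_iUnion₂ (s := fun K (_ : K ∈ T) => interior (hull K)) K hK))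
  have h2 : MemLp (polyEval g) 2 (volume.restrict (interior (hull K))) := by
    rw [memLp_two_iff_integrable_sq (continuous_polyEval g).aestronglyMeasurable]
    exact (integrableOn_hull ((continuous_polyEval g).pow 2) K).mono_set interior_subset
  exact (h1.add h2).integrable_sq

/-! ### Piecewise polynomials -/

/-- The function `v` agrees with the polynomial `p K` in each triangle `K` of the mesh. -/
def AgreesWith (T : Finset (Finset Pt)) (v : Pt → ℝ) (p : Finset Pt → MvPolynomial (Fin 2) ℝ) :
    Prop :=
  ∀ K ∈ T, ∀ x ∈ interior (hull K), v x = polyEval (p K) x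

lemma IsPiecewisePoly.exists_agreesWith {k : ℕ} {v : Pt → ℝ} (hv : IsPiecewisePoly k T v) :
    ∃ p : Finset Pt → MvPolynomial (Fin 2) ℝ, (∀ K, (p K).totalDegree ≤ k) ∧ AgreesWith T v p := by
  choose! p hp using hv
  refine ⟨fun K => if K ∈ T then p K else 0, fun K => ?_, fun K hK x hx => ?_⟩
  · dsimp only
    split_ifs with h
    · exact (hp K h).1
    · simp
  · simp only [if_pos hK]; exact (hp K hK).2 x hx

section AgreesWith

variable {v : Pt → ℝ} {p : Finset Pt → MvPolynomial (Fin 2) ℝ}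

lemma AgreesWith.eventuallyEq (h : AgreesWith T v p) {K : Finset Pt} (hK : K ∈ T) {x : Pt}
    (hx : x ∈ interior (hull K)) : v =ᶠ[𝓝 x] polyEval (p K) := by
  filter_upwards [isOpen_interior.mem_nhds hx] with y hy using h K hK y hy

lemma AgreesWith.laplacian_eq (h : AgreesWith T v p) {K : Finset Pt} (hK : K ∈ T) {x : Pt}
    (hx : x ∈ interior (hull K)) : Laplacian.laplacian v x = polyEval (polyLap (p K)) x := by
  rw [(InnerProductSpace.laplacian_congr_nhds (h.eventuallyEq hK hx)).eq_of_nhds,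
    laplacian_polyEval]

lemma AgreesWith.brokenGrad_eq (h : AgreesWith T v p) {K : Finset Pt} (hK : K ∈ T) {x : Pt}
    (hx : x ∈ interior (hull K)) : brokenGrad T v x = polyGrad (p K) x := by
  rw [brokenGrad, indicator_of_mem (mem_iUnion₂.2 ⟨K, hK, hx⟩), ← gradient_polyEval, gradient,
    gradient, (h.eventuallyEq hK hx).fderiv_eq]

lemma AgreesWith.trace_eq (h : AgreesWith T v p) (hT : IsTriangulation Ω T) {K : Finset Pt}
    (hK : K ∈ T) {x : Pt} (hx : x ∈ hull K) :
    trace K (brokenGrad T v) x = polyGrad (p K) x := by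
  refine extendFrom_eq (by rwa [(hT.isTriangle K hK).closure_interior]) ?_
  refine Tendsto.congr' ?_ ((continuous_polyGrad (p K)).tendsto x |>.mono_left nhdsWithin_le_nhds)
  filter_upwards [self_mem_nhdsWithin] with y hy using (h.brokenGrad_eq hK hy).symm

lemma AgreesWith.jump_eq (h : AgreesWith T v p) (hT : IsTriangulation Ω T) (N : EdgeNumbering)
    {E : Finset Pt} {x : Pt} (hx : x ∈ hull E) :
    jump T N E (brokenGrad T v) x = signedSum T N E (fun K => polyGrad (p K) x) := by
  refine Finset.sum_congr rfl fun K hK => ?_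
  rw [Finset.mem_filter] at hK
  rw [h.trace_eq hT hK.1 (hull_mono (mem_edgesOf.1 hK.2).1 hx)]

end AgreesWith

/-- The jump over `E` of the gradients of polynomials given on each triangle. -/
def polyJump (T : Finset (Finset Pt)) (N : EdgeNumbering) (p : Finset Pt → MvPolynomial (Fin 2) ℝ)
    (E : Finset Pt) (x : Pt) : Pt :=
  signedSum T N E (fun K => polyGrad (p K) x)

lemma continuous_polyJump (T : Finset (Finset Pt)) (N : EdgeNumbering)
    (p : Finset Pt → MvPolynomial (Fin 2) ℝ) (E : Finset Pt) : Continuous (polyJump T N p E) := by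
  unfold polyJump signedSum
  refine continuous_finsetSum _ fun K _ => ?_
  split_ifs
  · exact (continuous_polyGrad _).neg
  · exact continuous_polyGrad _

lemma polyJump_add (T : Finset (Finset Pt)) (N : EdgeNumbering)
    (p q : Finset Pt → MvPolynomial (Fin 2) ℝ) (E : Finset Pt) (x : Pt) :
    polyJump T N p E x = polyJump T N q E x + polyJump T N (fun K => p K - q K) E x := by
  rw [polyJump, polyJump, polyJump, ← signedSum_add]
  simp [polyGrad_sub]

lemma IsTriangulation.norm_polyJump_sq_le (hT : IsTriangulation Ω T) {N : EdgeNumbering}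
    (hN : N.IsFor Ω T) (p : Finset Pt → MvPolynomial (Fin 2) ℝ) (E : Finset Pt) (x : Pt) :
    ‖polyJump T N p E x‖ ^ 2 ≤
      2 * ∑ K ∈ T.filter (fun K => E ∈ edgesOf K), ‖polyGrad (p K) x‖ ^ 2 := by
  have h1 : ‖polyJump T N p E x‖ ≤
      ∑ K ∈ T.filter (fun K => E ∈ edgesOf K), ‖polyGrad (p K) x‖ := by
    refine (norm_sum_le _ _).trans (Finset.sum_le_sum fun K _ => ?_)
    split_ifs <;> simp
  calc ‖polyJump T N p E x‖ ^ 2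
      ≤ (∑ K ∈ T.filter (fun K => E ∈ edgesOf K), ‖polyGrad (p K) x‖) ^ 2 :=
        pow_le_pow_left₀ (norm_nonneg _) h1 2
    _ ≤ _ := sq_sum_le_card_mul_sum_sq
    _ ≤ _ := by
        refine mul_le_mul_of_nonneg_right ?_ (Finset.sum_nonneg fun _ _ => sq_nonneg _)
        exact_mod_cast hT.card_adjacent_le hN E

lemma EdgeNumbering.norm_tangent_le (N : EdgeNumbering) (E : Finset Pt) : ‖N.tangent E‖ ≤ 1 := by
  rw [tangent, norm_smul, norm_inv, Real.norm_of_nonneg dist_nonneg, dist_comm, dist_eq_norm]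
  exact inv_mul_le_one

lemma EdgeNumbering.norm_normal_le (N : EdgeNumbering) (E : Finset Pt) : ‖N.normal E‖ ≤ 1 := by
  have h : ‖N.normal E‖ ^ 2 = ‖N.tangent E‖ ^ 2 := by
    rw [norm_sq_pt, norm_sq_pt, normal]; simp; ring
  rw [(pow_left_inj₀ (norm_nonneg _) (norm_nonneg _) two_ne_zero).1 h]
  exact N.norm_tangent_le E

lemma inner_sq_le {x d : Pt} (hd : ‖d‖ ≤ 1) : ⟪x, d⟫ ^ 2 ≤ ‖x‖ ^ 2 := by
  rw [← sq_abs]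
  refine pow_le_pow_left₀ (abs_nonneg _) ((abs_real_inner_le_norm x d).trans ?_) 2
  exact mul_le_of_le_one_right (norm_nonneg _) hd

lemma sum_edgesOf_comm (T : Finset (Finset Pt)) (F : Finset Pt → Finset Pt → ℝ) :
    ∑ K ∈ T, ∑ E ∈ edgesOf K, F K E =
      ∑ E ∈ edges T, ∑ K ∈ T.filter (fun K => E ∈ edgesOf K), F K E := by
  refine Finset.sum_comm' fun K E => ?_
  rw [Finset.mem_filter, mem_edges]
  constructor
  · rintro ⟨hK, hE⟩; exact ⟨⟨hK, hE⟩, K, hK, hE⟩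
  · rintro ⟨⟨hK, hE⟩, -⟩; exact ⟨hK, hE⟩

/-- Each triangle is adjacent to at most six pairs of a triangle and one of its edges. -/
lemma IsTriangulation.sum_adjacent_le (hT : IsTriangulation Ω T) {N : EdgeNumbering}
    (hN : N.IsFor Ω T) {I : Finset Pt → ℝ} (hI : ∀ K, 0 ≤ I K) :
    ∑ K ∈ T, ∑ E ∈ edgesOf K, ∑ L ∈ T.filter (fun L => E ∈ edgesOf L), I L ≤
      6 * ∑ K ∈ T, I K := by
  rw [sum_edgesOf_comm]
  calc ∑ E ∈ edges T, ∑ _K ∈ T.filter (fun K => E ∈ edgesOf K),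
        ∑ L ∈ T.filter (fun L => E ∈ edgesOf L), I L
      ≤ ∑ E ∈ edges T, 2 * ∑ L ∈ T.filter (fun L => E ∈ edgesOf L), I L := by
        refine Finset.sum_le_sum fun E _ => ?_
        rw [Finset.sum_const, nsmul_eq_mul]
        refine mul_le_mul_of_nonneg_right ?_ (Finset.sum_nonneg fun _ _ => hI _)
        exact_mod_cast hT.card_adjacent_le hN E
    _ = 2 * ∑ K ∈ T, ∑ E ∈ edgesOf K, I K := by
        rw [← Finset.mul_sum, sum_edgesOf_comm T (fun K _ => I K)]
    _ = 2 * ∑ K ∈ T, 3 * I K := by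
        congr 1
        refine Finset.sum_congr rfl fun K hK => ?_
        rw [Finset.sum_const, edgesOf, Finset.card_powersetCard, (hT.isTriangle K hK).1]
        norm_num
    _ = 6 * ∑ K ∈ T, I K := by rw [← Finset.mul_sum]; ring

/-- The `L²` norm of the difference of broken gradients as a sum over the fine mesh. -/
lemma l2Norm_sq_eq (hΩ : IsPolygonalLipschitzDomain Ω) (hT' : IsTriangulation Ω T')
    {v v' : Pt → ℝ} {p p' : Finset Pt → MvPolynomial (Fin 2) ℝ} (hv : AgreesWith T v p)
    (hv' : AgreesWith T' v' p') {P : Finset Pt → Finset Pt}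
    (hP : ∀ K' ∈ T', P K' ∈ T ∧ hull K' ⊆ hull (P K')) :
    l2Norm Ω (fun x => brokenGrad T v x - brokenGrad T' v' x) ^ 2 =
      ∑ K' ∈ T', ∫ x in hull K', ‖polyGrad (p' K' - p (P K')) x‖ ^ 2 := by
  have heq : ∀ K' ∈ T', EqOn (fun x => ‖brokenGrad T v x - brokenGrad T' v' x‖ ^ 2)
      (fun x => ‖polyGrad (p' K' - p (P K')) x‖ ^ 2) (interior (hull K')) := by
    intro K' hK' x hx
    have h1 := hv.brokenGrad_eq (hP K' hK').1 (interior_mono (hP K' hK').2 hx)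
    have h2 := hv'.brokenGrad_eq hK' hx
    simp only [h1, h2, polyGrad_sub]
    rw [norm_sub_rev]
  rw [l2Norm, Real.sq_sqrt (integral_nonneg fun _ => sq_nonneg _),
    ← setIntegral_congr_set (hT'.iUnion_interior_ae_eq hΩ), integral_biUnion_finset]
  · refine Finset.sum_congr rfl fun K' hK' => ?_
    rw [setIntegral_congr_fun isOpen_interior.measurableSet (heq K' hK'), setIntegral_interior]
  · exact fun _ _ => isOpen_interior.measurableSet
  · exact fun K hK L hL hne => hT'.disjoint_interior hK hL hne
  · intro K' hK'
    rw [integrableOn_congr_fun (heq K' hK') isOpen_interior.measurableSet]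
    exact (integrableOn_hull ((continuous_polyGrad _).norm.pow 2) K').mono_set interior_subset

/-! ### Reduction of the estimator of the coarse function on the fine mesh -/

section Reduction

variable {N N' : EdgeNumbering} {P : Finset Pt → Finset Pt}
  {p : Finset Pt → MvPolynomial (Fin 2) ℝ}

/-- On an edge of the fine mesh in the coarse triangle `K`, the jump of the coarse function either
vanishes or is the jump over an edge of `K`, up to sign. -/
lemma Refines.polyJump_subedge (hR : Refines T T') (hT : IsTriangulation Ω T)
    (hT' : IsTriangulation Ω T') (hN : N.IsFor Ω T) (hN' : N'.IsFor Ω T')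
    (hP : ∀ K' ∈ T', P K' ∈ T ∧ hull K' ⊆ hull (P K')) {K' E' : Finset Pt} (hK' : K' ∈ T')
    (hE' : E' ∈ edgesOf K') :
    (∀ x, polyJump T' N' (fun K' => p (P K')) E' x = 0) ∨
      ∃ E ∈ edgesOf (P K'), hull E' ⊆ hull E ∧ ∀ x,
        ⟪polyJump T' N' (fun K' => p (P K')) E' x, N'.normal E'⟫ ^ 2 =
          ⟪polyJump T N p E x, N.normal E⟫ ^ 2 ∧
        ⟪polyJump T' N' (fun K' => p (P K')) E' x, N'.tangent E'⟫ ^ 2 =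
          ⟪polyJump T N p E x, N.tangent E⟫ ^ 2 := by
  have hE'e : E' ∈ edges T' := mem_edges.2 ⟨K', hK', hE'⟩
  have hends := hN'.ends E' hE'e
  obtain ⟨hPK, hsub⟩ := hP K' hK'
  have hmem : ∀ y, y = N'.fst E' ∨ y = N'.snd E' → y ∈ hull (P K') := fun y hy =>
    hsub (mem_hull_of_mem ((mem_edgesOf.1 hE').1 (by rw [hends]; simpa using hy)))
  rcases (hT.isTriangle _ hPK).segment_subset_edge_or
    (hmem _ (Or.inl rfl)) (hmem _ (Or.inr rfl)) with ⟨E, hE, hs⟩ | hint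
  · right
    rw [← hends] at hs
    refine ⟨E, hE, hs, fun x => ?_⟩
    obtain ⟨σ, hσ, htan, hnor, hsum⟩ := hR.signedSum_subedge hT hT' hN hN' hP
      (mem_edges.2 ⟨_, hPK, hE⟩) hE'e hs
    have h1 := hsum fun K => polyGrad (p K) x
    simp only [polyJump, h1, htan, hnor, inner_smul_left, inner_smul_right, conj_trivial,
      mul_pow, hσ, one_mul]
    exact ⟨trivial, trivial⟩
  · left
    intro x
    refine hT'.signedSum_eq_zero hN' hE'e (S := T'.filter fun L => hull L ⊆ hull (P K'))
      (Finset.filter_subset _ _) ?_ (c := polyGrad (p (P K')) x) ?_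
    · filter_upwards [mem_interior_iff_mem_nhds.1 hint] with y hy
      obtain ⟨L, hL, hLs, hyL⟩ := hR.cover _ hPK y hy
      exact ⟨L, Finset.mem_filter.2 ⟨hL, hLs⟩, hyL⟩
    · intro L hL
      rw [Finset.mem_filter] at hL
      dsimp only
      rw [hT.eq_of_hull_subset (hP L hL.1).1 hPK (hT'.isTriangle L hL.1) (hP L hL.1).2 hL.2]

/-- Summation of the squared jumps over all edges of the fine mesh in one coarse triangle. -/
lemma sum_subedges_le (hT' : IsTriangulation Ω T') (hN' : N'.IsFor Ω T') {K : Finset Pt}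
    {S : Finset (Finset Pt)} (hS : S ⊆ T') (hsub : ∀ K' ∈ S, hull K' ⊆ hull K)
    (hK : IsTriangle K) {B B' : Finset Pt → Prop} [DecidablePred B]
    [DecidablePred B'] {g h : Finset Pt → Pt → ℝ}
    (hB : ∀ E E', hull E' ⊆ hull E → B' E' → B E)
    (hh : ∀ E, Continuous (h E)) (h0 : ∀ E x, 0 ≤ h E x)
    (hgh : ∀ K' ∈ S, ∀ E' ∈ edgesOf K', (∀ x, g E' x = 0) ∨
      ∃ E ∈ edgesOf K, hull E' ⊆ hull E ∧ ∀ x, g E' x = h E x) :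
    ∑ K' ∈ S, ∑ E' ∈ (edgesOf K').filter B', edgeIntegral E' (g E') ≤
      ∑ E ∈ (edgesOf K).filter B, edgeIntegral E (h E) := by
  have h1 : ∀ K' ∈ S, ∀ E' ∈ (edgesOf K').filter B', edgeIntegral E' (g E') ≤
      ∑ E ∈ (edgesOf K).filter B, if hull E' ⊆ hull E then edgeIntegral E' (h E) else 0 := by
    intro K' hK' E' hE'
    rw [Finset.mem_filter] at hE'
    have hnn : ∀ E ∈ (edgesOf K).filter B,
        0 ≤ if hull E' ⊆ hull E then edgeIntegral E' (h E) else 0 := fun E _ => by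
      split_ifs
      · exact edgeIntegral_nonneg (h0 E)
      · exact le_rfl
    rcases hgh K' hK' E' hE'.1 with hz | ⟨E, hE, hs, heq⟩
    · rw [edgeIntegral_congr (h := fun _ => 0) fun x _ => hz x]
      simpa [edgeIntegral] using Finset.sum_nonneg hnn
    · have := Finset.single_le_sum hnn (Finset.mem_filter.2 ⟨hE, hB E E' hs hE'.2⟩)
      rw [if_pos hs] at this
      rwa [edgeIntegral_congr fun x _ => heq x]
  refine (Finset.sum_le_sum fun K' hK' => Finset.sum_le_sum (h1 K' hK')).trans ?_
  rw [Finset.sum_congr rfl fun K' _ => Finset.sum_comm, Finset.sum_comm]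
  refine Finset.sum_le_sum fun E hE => ?_
  have hEK := (Finset.mem_filter.1 hE).1
  obtain ⟨a, b, -, hab⟩ := exists_pair_of_mem_edgesOf hEK
  obtain ⟨z, hz, -, hc⟩ := hK.exists_apex hEK hab
  calc ∑ K' ∈ S, ∑ E' ∈ (edgesOf K').filter B',
        (if hull E' ⊆ hull E then edgeIntegral E' (h E) else 0)
      ≤ ∑ K' ∈ S, ∑ E' ∈ (edgesOf K').filter (fun E' => hull E' ⊆ hull E),
          edgeIntegral E' (h E) := by
        refine Finset.sum_le_sum fun K' _ => ?_
        rw [← Finset.sum_filter, Finset.filter_filter]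
        refine Finset.sum_le_sum_of_subset_of_nonneg ?_ fun E' _ _ => edgeIntegral_nonneg (h0 E)
        intro E' hE'
        simp only [Finset.mem_filter] at hE' ⊢
        exact ⟨hE'.1, hE'.2.2⟩
    _ = ∑ E' ∈ S.biUnion (fun K' => (edgesOf K').filter (fun E' => hull E' ⊆ hull E)),
          edgeIntegral E' (h E) := by
        refine (Finset.sum_biUnion fun K' hK' L' hL' hne => ?_).symm
        rw [Function.onFun, Finset.disjoint_left]
        intro E' hE' hE''
        rw [Finset.mem_filter] at hE' hE''
        refine hne ?_
        have hE'e : E' ∈ edges T' := mem_edges.2 ⟨K', hS hK', hE'.1⟩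
        have hne' := hN'.fst_ne_snd hE'e
        have hends := hN'.ends E' hE'e
        have hs := hE'.2
        rw [hends, hab] at hs
        obtain ⟨-, s, τ, hτ, k1, k2⟩ := subsegment hne' hs
        have hcross : ∀ x, cross (N'.snd E' - N'.fst E') (x - N'.fst E') =
            τ * cross (b - a) (x - a) := fun x => by
          have e : x - N'.fst E' = (x - a) + (-s) • (b - a) := by
            have : N'.fst E' = a + s • (b - a) := by rw [← k1]; abel
            rw [this]; module
          rw [e, k2, cross_smul_left, cross_add_right, cross_smul_right, cross_self]; ring
        have hside : ∀ L ∈ S, E' ∈ edgesOf L → ∃ w, L = {w, N'.fst E', N'.snd E'} ∧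
            0 < cross (b - a) (w - a) * cross (b - a) (z - a) := by
          intro L hL hEL
          obtain ⟨w, hw, hw0⟩ := hN'.exists_apex hT' (hS hL) hEL
          refine ⟨w, hw, ?_⟩
          have hwm : w ∈ hull {z, a, b} := by
            rw [← hz]; exact hsub L hL (mem_hull_of_mem (by rw [hw]; simp))
          have k3 := ((mem_hull_triple hc w).1 hwm).2.2
          rw [← cross_apex z a b] at k3 hc
          rw [hcross] at hw0
          have k4 : cross (b - a) (w - a) ≠ 0 := fun h => hw0 (by rw [h, mul_zero])
          have k5 : 0 < cross (b - a) (w - a) / cross (b - a) (z - a) :=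
            lt_of_le_of_ne k3 (div_ne_zero k4 hc).symm
          rcases div_pos_iff.1 k5 with h | h
          · exact mul_pos h.1 h.2
          · exact mul_pos_of_neg_of_neg h.1 h.2
        obtain ⟨w, hw, hw1⟩ := hside K' hK' hE'.1
        obtain ⟨y, hy, hy1⟩ := hside L' hL' hE''.1
        have m1 := hS hK'
        have m2 := hS hL'
        rw [hw] at m1 ⊢
        rw [hy] at m2 ⊢
        refine hT'.eq_of_same_side m1 m2 ?_
        rw [hcross, hcross]
        have hzz : 0 < cross (b - a) (z - a) ^ 2 := by rw [cross_apex]; positivity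
        have hττ : 0 < τ ^ 2 := by positivity
        have := mul_pos hw1 hy1
        have h3 : 0 < (cross (b - a) (w - a) * cross (b - a) (y - a)) *
            cross (b - a) (z - a) ^ 2 := by nlinarith
        have h4 := (mul_pos_iff_of_pos_right hzz).1 h3
        nlinarith [mul_pos hττ h4]
    _ ≤ edgeIntegral E (h E) := by
        refine sum_edgeIntegral_le hT' hEK ?_ ?_ (hh E) (h0 E)
        · intro E' hE'
          obtain ⟨K', hK', hE''⟩ := Finset.mem_biUnion.1 hE'
          exact mem_edges.2 ⟨K', hS hK', (Finset.mem_filter.1 hE'').1⟩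
        · intro E' hE'
          obtain ⟨K', hK', hE''⟩ := Finset.mem_biUnion.1 hE'
          exact (Finset.mem_filter.1 hE'').2

/-- The estimator of a piecewise polynomial function in terms of its polynomials. -/
def polyEta (Ω : Set Pt) (T : Finset (Finset Pt)) (N : EdgeNumbering) (f : Pt → ℝ)
    (p : Finset Pt → MvPolynomial (Fin 2) ℝ) (K : Finset Pt) : ℝ :=
  area K * (∫ x in interior (hull K), (f x + polyEval (polyLap (p K)) x) ^ 2) +
    √(area K) * (∑ E ∈ interiorEdgesOf Ω K,
      edgeIntegral E (fun x => ⟪polyJump T N p E x, N.normal E⟫ ^ 2)) +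
    √(area K) * ∑ E ∈ edgesOf K,
      edgeIntegral E (fun x => ⟪polyJump T N p E x, N.tangent E⟫ ^ 2)

lemma AgreesWith.muSq_add_nuSq {v : Pt → ℝ} (h : AgreesWith T v p) (hT : IsTriangulation Ω T)
    (N : EdgeNumbering) (f : Pt → ℝ) {K : Finset Pt} (hK : K ∈ T) :
    muSq Ω T N f v K + nuSq T N v K = polyEta Ω T N f p K := by
  rw [muSq, nuSq, polyEta]
  congr 1
  · congr 1
    · congr 1
      exact setIntegral_congr_fun isOpen_interior.measurableSet fun x hx => by
        simp only [h.laplacian_eq hK hx]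
    · congr 1
      exact Finset.sum_congr rfl fun E _ => edgeIntegral_congr fun x hx => by
        rw [h.jump_eq hT N hx]; rfl
  · congr 1
    exact Finset.sum_congr rfl fun E _ => edgeIntegral_congr fun x hx => by
      rw [h.jump_eq hT N hx]; rfl

lemma polyEta_nonneg (f : Pt → ℝ) (K : Finset Pt) : 0 ≤ polyEta Ω T N f p K := by
  have h1 := area_nonneg K
  refine add_nonneg (add_nonneg ?_ ?_) ?_
  · exact mul_nonneg h1 (integral_nonneg fun _ => sq_nonneg _)
  · exact mul_nonneg (Real.sqrt_nonneg _)
      (Finset.sum_nonneg fun _ _ => edgeIntegral_nonneg fun _ => sq_nonneg _)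
  · exact mul_nonneg (Real.sqrt_nonneg _)
      (Finset.sum_nonneg fun _ _ => edgeIntegral_nonneg fun _ => sq_nonneg _)

lemma AgreesWith.eta_sq {v : Pt → ℝ} (h : AgreesWith T v p) (hT : IsTriangulation Ω T)
    (N : EdgeNumbering) (f : Pt → ℝ) {S : Finset (Finset Pt)} (hS : S ⊆ T) :
    eta Ω T N f v S ^ 2 = ∑ K ∈ S, polyEta Ω T N f p K := by
  have h1 : ∑ K ∈ S, (muSq Ω T N f v K + nuSq T N v K) = ∑ K ∈ S, polyEta Ω T N f p K :=
    Finset.sum_congr rfl fun K hK => h.muSq_add_nuSq hT N f (hS hK)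
  rw [eta, h1, Real.sq_sqrt (Finset.sum_nonneg fun K _ => polyEta_nonneg f K)]

/-- The estimator of the coarse function on the refined triangles within one coarse triangle. -/
lemma sum_polyEta_children_le (hΩ : IsPolygonalLipschitzDomain Ω) {f : Pt → ℝ}
    (hf : MemLp f 2 (volume.restrict Ω)) (hR : Refines T T') (hT : IsTriangulation Ω T)
    (hT' : IsTriangulation Ω T') (hN : N.IsFor Ω T) (hN' : N'.IsFor Ω T')
    (hP : ∀ K' ∈ T', P K' ∈ T ∧ hull K' ⊆ hull (P K')) {K : Finset Pt} (hK : K ∈ T)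
    {S : Finset (Finset Pt)} (hS : S ⊆ T') (hPS : ∀ K' ∈ S, P K' = K)
    (harea : ∀ K' ∈ S, area K' ≤ area K / 2) :
    ∑ K' ∈ S, polyEta Ω T' N' f (fun K' => p (P K')) K' ≤ 1 / √2 * polyEta Ω T N f p K := by
  have hsub : ∀ K' ∈ S, hull K' ⊆ hull K := fun K' hK' => by
    rw [← hPS K' hK']; exact (hP K' (hS hK')).2
  have hAK := area_nonneg K
  have hs2 : 1 / 2 ≤ 1 / √2 := by
    apply one_div_le_one_div_of_le (by positivity)
    rw [Real.sqrt_le_left (by norm_num)]; norm_num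
  have hsq : ∀ K' ∈ S, √(area K') ≤ 1 / √2 * √(area K) := fun K' hK' => by
    rw [one_div_mul_eq_div, ← Real.sqrt_div hAK]
    exact Real.sqrt_le_sqrt (harea K' hK')
  have hint := hT.integrableOn_residual hΩ hf hK (polyLap (p K))
  have hvol : ∑ K' ∈ S, area K' *
      (∫ x in interior (hull K'), (f x + polyEval (polyLap (p (P K'))) x) ^ 2) ≤
      1 / √2 * (area K * ∫ x in interior (hull K), (f x + polyEval (polyLap (p K)) x) ^ 2) := by
    calc ∑ K' ∈ S, area K' *
          (∫ x in interior (hull K'), (f x + polyEval (polyLap (p (P K'))) x) ^ 2)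
        ≤ ∑ K' ∈ S, area K / 2 *
          (∫ x in interior (hull K'), (f x + polyEval (polyLap (p K)) x) ^ 2) := by
          refine Finset.sum_le_sum fun K' hK' => ?_
          rw [hPS K' hK']
          exact mul_le_mul_of_nonneg_right (harea K' hK') (integral_nonneg fun _ => sq_nonneg _)
      _ = area K / 2 * ∫ x in ⋃ K' ∈ S, interior (hull K'),
            (f x + polyEval (polyLap (p K)) x) ^ 2 := by
          rw [← Finset.mul_sum, integral_biUnion_finset]
          · exact fun _ _ => isOpen_interior.measurableSet
          · exact fun K₁ h₁ K₂ h₂ hne => hT'.disjoint_interior (hS h₁) (hS h₂) hne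
          · exact fun K' hK' => hint.mono_set (interior_mono (hsub K' hK'))
      _ ≤ area K / 2 * ∫ x in interior (hull K), (f x + polyEval (polyLap (p K)) x) ^ 2 := by
          refine mul_le_mul_of_nonneg_left (setIntegral_mono_set hint
            (Eventually.of_forall fun _ => sq_nonneg _) ?_) (by positivity)
          exact (iUnion₂_subset fun K' hK' => interior_mono (hsub K' hK')).eventuallyLE
      _ ≤ _ := by
          have h0 : 0 ≤ area K * ∫ x in interior (hull K),
              (f x + polyEval (polyLap (p K)) x) ^ 2 :=
            mul_nonneg hAK (integral_nonneg fun _ => sq_nonneg _)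
          have := mul_le_mul_of_nonneg_right hs2 h0
          linarith
  have hedge : ∀ (B B' : Finset Pt → Prop) [DecidablePred B] [DecidablePred B'], (∀ E E', hull E' ⊆ hull E → B' E' → B E) →
      ∀ d d' : Finset Pt → Pt, (∀ K' ∈ S, ∀ E' ∈ edgesOf K',
        (∀ x, ⟪polyJump T' N' (fun K' => p (P K')) E' x, d' E'⟫ ^ 2 = 0) ∨
        ∃ E ∈ edgesOf K, hull E' ⊆ hull E ∧ ∀ x,
          ⟪polyJump T' N' (fun K' => p (P K')) E' x, d' E'⟫ ^ 2 =
            ⟪polyJump T N p E x, d E⟫ ^ 2) →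
      ∑ K' ∈ S, √(area K') * ∑ E' ∈ (edgesOf K').filter B', edgeIntegral E'
          (fun x => ⟪polyJump T' N' (fun K' => p (P K')) E' x, d' E'⟫ ^ 2) ≤
        1 / √2 * (√(area K) * ∑ E ∈ (edgesOf K).filter B,
          edgeIntegral E (fun x => ⟪polyJump T N p E x, d E⟫ ^ 2)) := by
    intro B B' _ _ hB d d' hd
    have h1 := sum_subedges_le hT' hN' hS hsub (hT.isTriangle K hK) hB
      (g := fun E' x => ⟪polyJump T' N' (fun K' => p (P K')) E' x, d' E'⟫ ^ 2)
      (h := fun E x => ⟪polyJump T N p E x, d E⟫ ^ 2)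
      (fun E => ((continuous_polyJump T N p E).inner continuous_const).pow 2)
      (fun _ _ => sq_nonneg _) hd
    calc _ ≤ ∑ K' ∈ S, (1 / √2 * √(area K)) * ∑ E' ∈ (edgesOf K').filter B', edgeIntegral E'
            (fun x => ⟪polyJump T' N' (fun K' => p (P K')) E' x, d' E'⟫ ^ 2) :=
        Finset.sum_le_sum fun K' hK' => mul_le_mul_of_nonneg_right (hsq K' hK')
          (Finset.sum_nonneg fun _ _ => edgeIntegral_nonneg fun _ => sq_nonneg _)
      _ ≤ (1 / √2 * √(area K)) * ∑ E ∈ (edgesOf K).filter B,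
          edgeIntegral E (fun x => ⟪polyJump T N p E x, d E⟫ ^ 2) := by
        rw [← Finset.mul_sum]
        exact mul_le_mul_of_nonneg_left h1 (by positivity)
      _ = _ := by ring
  have hcase : ∀ K' ∈ S, ∀ E' ∈ edgesOf K', _ := fun K' hK' E' hE' =>
    hR.polyJump_subedge (p := p) hT hT' hN hN' hP (hS hK') hE'
  have hnor := hedge (fun E => ¬ IsBoundaryEdge Ω E) (fun E => ¬ IsBoundaryEdge Ω E)
    (fun E E' hs hE' hE => hE' (hs.trans hE)) N.normal N'.normal fun K' hK' E' hE' => by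
      rcases hcase K' hK' E' hE' with h | ⟨E, hE, hs, h⟩
      · exact Or.inl fun x => by rw [h x]; simp
      · exact Or.inr ⟨E, by rwa [hPS K' hK'] at hE, hs, fun x => (h x).1⟩
  have htan := hedge (fun _ => True) (fun _ => True) (fun _ _ _ _ => trivial) N.tangent N'.tangent
    fun K' hK' E' hE' => by
      rcases hcase K' hK' E' hE' with h | ⟨E, hE, hs, h⟩
      · exact Or.inl fun x => by rw [h x]; simp
      · exact Or.inr ⟨E, by rwa [hPS K' hK'] at hE, hs, fun x => (h x).2⟩
  simp only [Finset.filter_true] at htan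
  simp only [polyEta, Finset.sum_add_distrib, interiorEdgesOf]
  rw [mul_add, mul_add]
  refine add_le_add (add_le_add hvol ?_) htan
  convert hnor

end Reduction

/-! ### Stability of the estimator -/

lemma add_sq_le_weighted {δ : ℝ} (hδ : 0 < δ) (a b : ℝ) :
    (a + b) ^ 2 ≤ (1 + δ) * a ^ 2 + (1 + 1 / δ) * b ^ 2 := by
  have h : (1 + δ) * a ^ 2 + (1 + 1 / δ) * b ^ 2 - (a + b) ^ 2 = (δ * a - b) ^ 2 / δ := by
    field_simp; ring
  have : 0 ≤ (δ * a - b) ^ 2 / δ := by positivity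
  linarith

section Stability

variable {N : EdgeNumbering} {p q : Finset Pt → MvPolynomial (Fin 2) ℝ}

/-- The part of the stability estimate that involves the differences of the gradients. -/
def polyDiff (T : Finset (Finset Pt)) (N : EdgeNumbering)
    (w : Finset Pt → MvPolynomial (Fin 2) ℝ) (K : Finset Pt) : ℝ :=
  area K * (∫ x in hull K, polyEval (polyLap (w K)) x ^ 2) +
    2 * (√(area K) * ∑ E ∈ edgesOf K, edgeIntegral E (fun x => ‖polyJump T N w E x‖ ^ 2))

lemma edgeIntegral_polyJump_le {δ : ℝ} (hδ : 0 < δ) {K E : Finset Pt} (hE : E ∈ edgesOf K) {d : Pt}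
    (hd : ‖d‖ ≤ 1) :
    edgeIntegral E (fun x => ⟪polyJump T N p E x, d⟫ ^ 2) ≤
      (1 + δ) * edgeIntegral E (fun x => ⟪polyJump T N q E x, d⟫ ^ 2) +
        (1 + 1 / δ) * edgeIntegral E (fun x => ‖polyJump T N (fun K => p K - q K) E x‖ ^ 2) := by
  have hc : ∀ r : Finset Pt → MvPolynomial (Fin 2) ℝ,
      Continuous fun x => ⟪polyJump T N r E x, d⟫ ^ 2 := fun r =>
    ((continuous_polyJump T N r E).inner continuous_const).pow 2
  have hc' : Continuous fun x => ‖polyJump T N (fun K => p K - q K) E x‖ ^ 2 :=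
    (continuous_polyJump T N _ E).norm.pow 2
  rw [← edgeIntegral_const_mul, ← edgeIntegral_const_mul,
    ← edgeIntegral_add hE ((hc q).const_mul _) (hc'.const_mul _)]
  refine edgeIntegral_mono hE (hc p) (((hc q).const_mul _).add (hc'.const_mul _)) fun x _ => ?_
  rw [polyJump_add T N p q E x, inner_add_left]
  refine (add_sq_le_weighted hδ _ _).trans (add_le_add le_rfl ?_)
  exact mul_le_mul_of_nonneg_left (inner_sq_le hd) (by positivity)

lemma IsTriangulation.polyEta_le (hT : IsTriangulation Ω T) (hΩ : IsPolygonalLipschitzDomain Ω)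
    {f : Pt → ℝ} (hf : MemLp f 2 (volume.restrict Ω)) {δ : ℝ} (hδ : 0 < δ) {K : Finset Pt}
    (hK : K ∈ T) : polyEta Ω T N f p K ≤ (1 + δ) * polyEta Ω T N f q K +
      (1 + 1 / δ) * polyDiff T N (fun K => p K - q K) K := by
  have hδ' : 0 < 1 + 1 / δ := by positivity
  have hA := area_nonneg K
  have hq := hT.integrableOn_residual hΩ hf hK (polyLap (q K))
  have hpq : IntegrableOn (fun x => polyEval (polyLap (p K - q K)) x ^ 2) (interior (hull K)) :=
    (integrableOn_hull ((continuous_polyEval _).pow 2) K).mono_set interior_subset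
  have hvol : ∫ x in interior (hull K), (f x + polyEval (polyLap (p K)) x) ^ 2 ≤
      (1 + δ) * (∫ x in interior (hull K), (f x + polyEval (polyLap (q K)) x) ^ 2) +
        (1 + 1 / δ) * ∫ x in hull K, polyEval (polyLap (p K - q K)) x ^ 2 := by
    rw [← setIntegral_interior K (fun x => polyEval (polyLap (p K - q K)) x ^ 2),
      ← integral_const_mul, ← integral_const_mul,
      ← integral_add (hq.const_mul _) (hpq.const_mul _)]
    refine integral_mono (hT.integrableOn_residual hΩ hf hK (polyLap (p K)))
      ((hq.const_mul _).add (hpq.const_mul _)) fun x => ?_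
    have e : f x + polyEval (polyLap (p K)) x =
        (f x + polyEval (polyLap (q K)) x) + polyEval (polyLap (p K - q K)) x := by
      rw [polyLap_sub, polyEval_sub]; ring
    simp only [e]
    exact add_sq_le_weighted hδ _ _
  have hnor : ∑ E ∈ interiorEdgesOf Ω K,
      edgeIntegral E (fun x => ⟪polyJump T N p E x, N.normal E⟫ ^ 2) ≤
      (1 + δ) * (∑ E ∈ interiorEdgesOf Ω K,
        edgeIntegral E (fun x => ⟪polyJump T N q E x, N.normal E⟫ ^ 2)) +
      (1 + 1 / δ) * ∑ E ∈ edgesOf K,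
        edgeIntegral E (fun x => ‖polyJump T N (fun K => p K - q K) E x‖ ^ 2) := by
    have hs : interiorEdgesOf Ω K ⊆ edgesOf K := Finset.filter_subset _ _
    refine (Finset.sum_le_sum fun E hE =>
      edgeIntegral_polyJump_le (q := q) hδ (hs hE) (N.norm_normal_le E)).trans ?_
    rw [Finset.sum_add_distrib, ← Finset.mul_sum, ← Finset.mul_sum]
    refine add_le_add le_rfl (mul_le_mul_of_nonneg_left ?_ hδ'.le)
    exact Finset.sum_le_sum_of_subset_of_nonneg hs fun _ _ _ =>
      edgeIntegral_nonneg fun _ => sq_nonneg _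
  have htan : ∑ E ∈ edgesOf K,
      edgeIntegral E (fun x => ⟪polyJump T N p E x, N.tangent E⟫ ^ 2) ≤
      (1 + δ) * (∑ E ∈ edgesOf K,
        edgeIntegral E (fun x => ⟪polyJump T N q E x, N.tangent E⟫ ^ 2)) +
      (1 + 1 / δ) * ∑ E ∈ edgesOf K,
        edgeIntegral E (fun x => ‖polyJump T N (fun K => p K - q K) E x‖ ^ 2) := by
    refine (Finset.sum_le_sum fun E hE =>
      edgeIntegral_polyJump_le (q := q) hδ hE (N.norm_tangent_le E)).trans ?_
    rw [Finset.sum_add_distrib, ← Finset.mul_sum, ← Finset.mul_sum]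
  have h1 := mul_le_mul_of_nonneg_left hvol hA
  have h2 := mul_le_mul_of_nonneg_left hnor (Real.sqrt_nonneg (area K))
  have h3 := mul_le_mul_of_nonneg_left htan (Real.sqrt_nonneg (area K))
  rw [polyEta, polyEta, polyDiff]
  refine (add_le_add (add_le_add h1 h2) h3).trans (le_of_eq ?_)
  ring

/-- The differences are bounded by the `L²` norm of the broken gradient. -/
lemma exists_sum_polyDiff_le (k : ℕ) (σ : ℝ) : ∃ C : ℝ, 0 ≤ C ∧ ∀ (Ω : Set Pt)
    (T : Finset (Finset Pt)) (N : EdgeNumbering), IsTriangulation Ω T → N.IsFor Ω T →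
    (∀ K ∈ T, ShapeBound σ K) → ∀ w : Finset Pt → MvPolynomial (Fin 2) ℝ,
    (∀ K, (w K).totalDegree ≤ k) → ∀ S ⊆ T,
      ∑ K ∈ S, polyDiff T N w K ≤ C * ∑ K ∈ T, ∫ x in hull K, ‖polyGrad (w K) x‖ ^ 2 := by
  obtain ⟨C₁, hC₁0, hC₁⟩ := exists_polyLap_le k
  obtain ⟨C₂, hC₂0, hC₂⟩ := exists_trace_le k σ
  refine ⟨C₁ * |σ| + 24 * C₂, by positivity, fun Ω T N hT hN hσ w hw S hS => ?_⟩
  set I : Finset Pt → ℝ := fun K => ∫ x in hull K, ‖polyGrad (w K) x‖ ^ 2 with hI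
  have hI0 : ∀ K, 0 ≤ I K := fun K => integral_nonneg fun _ => sq_nonneg _
  have hK : ∀ K ∈ T, polyDiff T N w K ≤ C₁ * |σ| * I K +
      4 * C₂ * ∑ E ∈ edgesOf K, ∑ L ∈ T.filter (fun L => E ∈ edgesOf L), I L := by
    intro K hK
    have h1 : area K * (∫ x in hull K, polyEval (polyLap (w K)) x ^ 2) ≤ C₁ * |σ| * I K :=
      (hC₁ σ K (hT.isTriangle K hK) (hσ K hK) _ (hw K)).trans
        (mul_le_mul_of_nonneg_right (mul_le_mul_of_nonneg_left (le_abs_self σ) hC₁0) (hI0 K))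
    have h2 : √(area K) * ∑ E ∈ edgesOf K,
        edgeIntegral E (fun x => ‖polyJump T N w E x‖ ^ 2) ≤
        2 * C₂ * ∑ E ∈ edgesOf K, ∑ L ∈ T.filter (fun L => E ∈ edgesOf L), I L := by
      rw [Finset.mul_sum, Finset.mul_sum]
      refine Finset.sum_le_sum fun E hE => ?_
      have hc : ∀ L, Continuous fun x => ‖polyGrad (w L) x‖ ^ 2 := fun L =>
        (continuous_polyGrad (w L)).norm.pow 2
      calc √(area K) * edgeIntegral E (fun x => ‖polyJump T N w E x‖ ^ 2)
          ≤ √(area K) * edgeIntegral E (fun x =>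
              2 * ∑ L ∈ T.filter (fun L => E ∈ edgesOf L), ‖polyGrad (w L) x‖ ^ 2) := by
            refine mul_le_mul_of_nonneg_left ?_ (Real.sqrt_nonneg _)
            exact edgeIntegral_mono hE ((continuous_polyJump T N w E).norm.pow 2)
              (continuous_const.mul (continuous_finsetSum _ fun L _ => hc L))
              fun x _ => hT.norm_polyJump_sq_le hN w E x
        _ = 2 * ∑ L ∈ T.filter (fun L => E ∈ edgesOf L),
              √(area K) * edgeIntegral E (fun x => ‖polyGrad (w L) x‖ ^ 2) := by
            rw [edgeIntegral_const_mul, edgeIntegral_sum hE _ hc, ← Finset.mul_sum]; ring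
        _ ≤ 2 * ∑ L ∈ T.filter (fun L => E ∈ edgesOf L), C₂ * I L := by
            refine mul_le_mul_of_nonneg_left (Finset.sum_le_sum fun L hL => ?_) (by norm_num)
            rw [Finset.mem_filter] at hL
            exact hC₂ K L E (hT.isTriangle K hK) (hT.isTriangle L hL.1) hE hL.2 (hσ K hK)
              (hσ L hL.1) _ (hw L)
        _ = _ := by rw [← Finset.mul_sum]; ring
    rw [polyDiff]
    linarith
  have hD0 : ∀ K, 0 ≤ polyDiff T N w K := fun K => by
    refine add_nonneg (mul_nonneg (area_nonneg K) (integral_nonneg fun _ => sq_nonneg _)) ?_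
    exact mul_nonneg (by norm_num) (mul_nonneg (Real.sqrt_nonneg _)
      (Finset.sum_nonneg fun _ _ => edgeIntegral_nonneg fun _ => sq_nonneg _))
  calc ∑ K ∈ S, polyDiff T N w K
      ≤ ∑ K ∈ T, polyDiff T N w K :=
        Finset.sum_le_sum_of_subset_of_nonneg hS fun K _ _ => hD0 K
    _ ≤ _ := Finset.sum_le_sum hK
    _ = C₁ * |σ| * ∑ K ∈ T, I K + 4 * C₂ * ∑ K ∈ T, ∑ E ∈ edgesOf K,
          ∑ L ∈ T.filter (fun L => E ∈ edgesOf L), I L := by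
        rw [Finset.sum_add_distrib, ← Finset.mul_sum, ← Finset.mul_sum]
    _ ≤ C₁ * |σ| * ∑ K ∈ T, I K + 4 * C₂ * (6 * ∑ K ∈ T, I K) :=
        add_le_add le_rfl
          (mul_le_mul_of_nonneg_left (hT.sum_adjacent_le hN hI0) (by positivity))
    _ = _ := by ring

end Stability

lemma Refines.exists_parent (hR : Refines T T') : ∃ P : Finset Pt → Finset Pt, ∀ K' ∈ T',
    (P K' ∈ T ∧ hull K' ⊆ hull (P K')) ∧ (K' = P K' ∨ area K' ≤ area (P K') / 2) := by
  choose! P hP using hR.parent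
  exact ⟨P, fun K' hK' => ⟨⟨(hP K' hK').1, (hP K' hK').2.1⟩, (hP K' hK').2.2⟩⟩

/-- The estimator of the coarse function on the refined triangles of the fine mesh. -/
lemma Refines.sum_polyEta_le (hR : Refines T T') (hΩ : IsPolygonalLipschitzDomain Ω) {f : Pt → ℝ}
    (hf : MemLp f 2 (volume.restrict Ω)) (hT : IsTriangulation Ω T) (hT' : IsTriangulation Ω T')
    {N N' : EdgeNumbering} (hN : N.IsFor Ω T) (hN' : N'.IsFor Ω T') {P : Finset Pt → Finset Pt}
    (hP : ∀ K' ∈ T', P K' ∈ T ∧ hull K' ⊆ hull (P K'))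
    (hA : ∀ K' ∈ T', K' = P K' ∨ area K' ≤ area (P K') / 2)
    (p : Finset Pt → MvPolynomial (Fin 2) ℝ) :
    ∑ K' ∈ T' \ T, polyEta Ω T' N' f (fun K' => p (P K')) K' ≤
      1 / √2 * ∑ K ∈ T \ T', polyEta Ω T N f p K := by
  have hhalf : ∀ K' ∈ T' \ T, area K' ≤ area (P K') / 2 := by
    intro K' hK'
    rw [Finset.mem_sdiff] at hK'
    rcases hA K' hK'.1 with h | h
    · exact absurd (h ▸ (hP K' hK'.1).1) hK'.2
    · exact h
  have hmaps : ∀ K' ∈ T' \ T, P K' ∈ T \ T' := by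
    intro K' hK'
    have ha := hhalf K' hK'
    rw [Finset.mem_sdiff] at hK' ⊢
    refine ⟨(hP K' hK'.1).1, fun h => ?_⟩
    have heq := hT'.eq_of_hull_subset h hK'.1 (hT'.isTriangle K' hK'.1) (hP K' hK'.1).2 Subset.rfl
    rw [heq] at ha
    linarith [(hT'.isTriangle K' hK'.1).area_pos]
  rw [← Finset.sum_fiberwise_of_maps_to hmaps, Finset.mul_sum]
  refine Finset.sum_le_sum fun K hK => ?_
  refine sum_polyEta_children_le hΩ hf hR hT hT' hN hN' hP (Finset.mem_sdiff.1 hK).1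
    ((Finset.filter_subset _ _).trans Finset.sdiff_subset)
    (fun K' hK' => (Finset.mem_filter.1 hK').2) fun K' hK' => ?_
  rw [Finset.mem_filter] at hK'
  rw [← hK'.2]
  exact hhalf K' hK'.1

end CRMesh

end

theorem mainTheorem3 (k : ℕ) (hk : Odd k) (γ : ℝ) :
    ∃ ρ₂ Λ₂ : ℝ, ρ₂ = (1 + √2) / √8 ∧ 0 < ρ₂ ∧ ρ₂ < 1 ∧ 0 < Λ₂ ∧
      ∀ (Ω : Set CRMesh.Pt), CRMesh.IsPolygonalLipschitzDomain Ω →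
      ∀ f : CRMesh.Pt → ℝ, MemLp f 2 (volume.restrict Ω) →
      ∀ M₀ : CRMesh.LabelledMesh, CRMesh.IsInitialMesh Ω M₀ →
        CRMesh.shapeRegularity M₀.tri ≤ γ →
      ∀ M M' : CRMesh.LabelledMesh,
        CRMesh.IsAdmissibleRefinement Ω M₀ M → CRMesh.IsAdmissibleRefinement Ω M M' →
      ∀ N N' : CRMesh.EdgeNumbering, N.IsFor Ω M.tri → N'.IsFor Ω M'.tri →
      ∀ v v' : CRMesh.Pt → ℝ,
        CRMesh.IsCR0 k Ω M.tri N v → CRMesh.IsCR0 k Ω M'.tri N' v' →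
        CRMesh.eta Ω M'.tri N' f v' (M'.tri \ M.tri) ^ 2 ≤
          ρ₂ * CRMesh.eta Ω M.tri N f v (M.tri \ M'.tri) ^ 2 +
            Λ₂ * CRMesh.l2Norm Ω
              (fun x => CRMesh.brokenGrad M.tri v x - CRMesh.brokenGrad M'.tri v' x) ^ 2 := by
  have hs2 : (0 : ℝ) < √2 := by positivity
  have hsq2 : √2 * √2 = (2 : ℝ) := Real.mul_self_sqrt (by norm_num)
  have hs8 : (√8 : ℝ) = 2 * √2 := by
    rw [show (8 : ℝ) = 2 ^ 2 * 2 by norm_num, Real.sqrt_mul (by norm_num),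
      Real.sqrt_sq (by norm_num)]
  have h1 : (1 : ℝ) < √2 := by
    rw [Real.lt_sqrt (by norm_num)]; norm_num
  obtain ⟨κ, hκ0, hκ⟩ := CRMesh.exists_newestBound_of_shapeRegularity γ
  obtain ⟨C, hC0, hC⟩ := CRMesh.exists_sum_polyDiff_le k (2 * κ / CRMesh.refArea)
  set δ : ℝ := (√2 - 1) / 2 with hδdef
  have hδ : 0 < δ := by rw [hδdef]; linarith
  have hδ' : 0 < 1 + 1 / δ := by positivity
  have hρ : (1 + δ) * (1 / √2) = (1 + √2) / √8 := by
    rw [hδdef, hs8]; field_simp; ring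
  refine ⟨(1 + √2) / √8, (1 + 1 / δ) * C + 1, rfl, by positivity, ?_, by positivity, ?_⟩
  · rw [hs8, div_lt_one (by positivity)]; linarith
  intro Ω hΩ f hf M₀ hM₀ hγ M M' hM hM' N N' hN hN' v v' hv hv'
  have hT := hM.2
  have hT' := hM'.2
  have hR₀ := CRMesh.refines_of_reflTransGen hM.1 (hκ Ω M₀ hM₀ hγ)
  obtain ⟨hR, hB⟩ := CRMesh.refines_of_reflTransGen hM'.1 hR₀.2
  obtain ⟨P, hP⟩ := hR.exists_parent
  obtain ⟨p, hpk, hp⟩ := hv.piecewisePoly.exists_agreesWith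
  obtain ⟨p', hpk', hp'⟩ := hv'.piecewisePoly.exists_agreesWith
  have hw : ∀ K, (p' K - p (P K)).totalDegree ≤ k := fun K =>
    (MvPolynomial.totalDegree_sub _ _).trans (max_le (hpk' K) (hpk (P K)))
  rw [hp'.eta_sq hT' N' f Finset.sdiff_subset, hp.eta_sq hT N f Finset.sdiff_subset,
    CRMesh.l2Norm_sq_eq hΩ hT' hp hp' fun K' hK' => (hP K' hK').1]
  have hA := hR.sum_polyEta_le hΩ hf hT hT' hN hN' (fun K' hK' => (hP K' hK').1)
    (fun K' hK' => (hP K' hK').2) p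
  have hD := hC Ω M'.tri N' hT' hN' (fun K hK => (hB K hK).shapeBound) _ hw (M'.tri \ M.tri)
    Finset.sdiff_subset
  have hE : ∑ K ∈ M'.tri \ M.tri, CRMesh.polyEta Ω M'.tri N' f p' K ≤
      (1 + δ) * ∑ K ∈ M'.tri \ M.tri, CRMesh.polyEta Ω M'.tri N' f (fun K => p (P K)) K +
        (1 + 1 / δ) * ∑ K ∈ M'.tri \ M.tri,
          CRMesh.polyDiff M'.tri N' (fun K => p' K - p (P K)) K := by
    rw [Finset.mul_sum, Finset.mul_sum, ← Finset.sum_add_distrib]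
    exact Finset.sum_le_sum fun K hK =>
      hT'.polyEta_le (q := fun K => p (P K)) hΩ hf hδ (Finset.sdiff_subset hK)
  have hI : 0 ≤ ∑ K' ∈ M'.tri, ∫ x in CRMesh.hull K',
      ‖CRMesh.polyGrad (p' K' - p (P K')) x‖ ^ 2 :=
    Finset.sum_nonneg fun _ _ => integral_nonneg fun _ => sq_nonneg _
  calc _ ≤ _ := hE
    _ ≤ (1 + δ) * (1 / √2 * ∑ K ∈ M.tri \ M'.tri, CRMesh.polyEta Ω M.tri N f p K) +
        (1 + 1 / δ) * (C * ∑ K' ∈ M'.tri, ∫ x in CRMesh.hull K',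
          ‖CRMesh.polyGrad (p' K' - p (P K')) x‖ ^ 2) :=
      add_le_add (mul_le_mul_of_nonneg_left hA (by positivity))
        (mul_le_mul_of_nonneg_left hD hδ'.le)
    _ ≤ _ := by
      rw [← mul_assoc, hρ, ← mul_assoc, add_mul _ (1 : ℝ)]
      linarith
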